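/- Let $k\ge 1$ be an odd integer, $m\ge 1$ an integer with $\gcd(k,m)=1$, and $n=5k$. For a finite field $\mathbb{F}$ of characteristic $2$ and $h:\mathbb{F}\to\mathbb{F}$, let $$\delta_h=\max_{a,b\in\mathbb{F},\,a\neq 0}\bigl|\{x\in\mathbb{F} : h(x+a)+h(x)=b\}\bigr|$$ be the differential uniformity of $h$; $h$ is called APN if $\delta_h=2$. Let $\mathcal{L}_1,\mathcal{L}_2$ be affine permutations of $\mathbb{F}_{2^k}$ over $\mathbb{F}_2$, let $g$ be a polynomial over $\mathbb{F}_{2^k}$ that represents the function $\mathcal{L}_1\circ x^{2^m-1}\circ\mathcal{L}_2$ on $\mathbb{F}_{2^k}$, and define on $\mathbb{F}_{2^n}\supset\mathbb{F}_{2^k}$ $$f(x)=g(x)+\bigl(g(x)+x^{d}\bigr)\bigl(x+x^{2^k}\bigr)^{2^n-1},\qquad d=2^{4k}+2^{3k}+2^{2k}+2^k-1$$ (so $f=g$ on $\mathbb{F}_{2^k}$, and $f(x)=x^d$ for $x\notin\mathbb{F}_{2^k}$). (i) If $x^{2^m-1}$ is APN on $\mathbb{F}_{2^k}$, then $f$ is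 a permutation of $\mathbb{F}_{2^n}$ with $\delta_f\le 4$; if $x^{2^m-1}$ has differential uniformity exactly $4$ on $\mathbb{F}_{2^k}$, then $f$ is a permutation of $\mathbb{F}_{2^n}$ with $\delta_f=4$. (ii) If $x^{2^m-1}$ has differential uniformity exactly $6$ on $\mathbb{F}_{2^k}$, then $f$ is a permutation of $\mathbb{F}_{2^n}$ with $\delta_f=6$. -/

import Mathlib

/-- `δ_f(a,b)`: the number of `x` with `f (x + a) + f x = b` (the derivative in characteristic two). -/
def diffCount {F : Type*} [Field F] [Fintype F] [DecidableEq F] (f : F → F) (a b : F) : ℕ :=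
  (Finset.univ.filter fun x : F => f (x + a) + f x = b).card

/-- The differential uniformity `δ_f`: the maximum of `δ_f(a,b)` over all `a ≠ 0` and all `b`. -/
def differentialUniformity {F : Type*} [Field F] [Fintype F] [DecidableEq F] (f : F → F) : ℕ :=
  (Finset.univ.filter fun p : F × F => p.1 ≠ 0).sup fun p => diffCount f p.1 p.2

/-- The exponent `2^{4k} + 2^{3k} + 2^{2k} + 2^k - 1` (the subtraction never truncates). -/
def dobbertinExp (k : ℕ) : ℕ := 2 ^ (4 * k) + 2 ^ (3 * k) + 2 ^ (2 * k) + 2 ^ k - 1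

/-- The function `f(x) = g(x) + (g(x) + x^d) (x + x^{2^k})^{2^n - 1}` on `F`, with `n = 5k`,
for a polynomial `g` over the subfield `K`. -/
noncomputable def modifiedDobbertin {K F : Type*} [Field K] [Field F] [Algebra K F]
    (k : ℕ) (g : Polynomial K) (x : F) : F :=
  Polynomial.aeval x g +
    (Polynomial.aeval x g + x ^ dobbertinExp k) * (x + x ^ 2 ^ k) ^ (2 ^ (5 * k) - 1)

open Polynomial

/-! Write `q = 2 ^ k`. Since `d + 2 = 1 + q + q² + q³ + q⁴`, every nonzero `x` in `F` satisfies `x ^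
d = N(x) / x² = (a / x)²`, where `N` is the norm to `K` and `a² = N(x)`. The core is that `x ^ d` is
APN on `F` (`eq_or_eq_add_of_pow_dobbertinExp`): four distinct elements of sum zero cannot satisfy
`∑ a i / x i = 0`.

Suppose they do. Small relations over `K` show that `x 0, x 1, x 2` are linearly independent. Their
six quadratic monomials are dependent in the five-dimensional `F`, so they lie on a conic over `K`;
parametrizing it gives `x i = μ Q_i(θ)` with quadratics `Q_i` over `K` and `θ ∉ K`
(`exists_quadratic_param`). The sextic `∑ a i ∏_{j ≠ i} Q_j`, with the `a i` rescaled to absorb `μ`,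
vanishes at the five conjugates of `θ`, leaving one linear cofactor `e T + f`. Taking its resultant
with `Q_i`, and using that the norm of `Q_i(θ)` is a square, gives `Q_i(f, e) = ∏_{j ≠ i} Res(Q_i,
Q_j)`. If no resultant vanishes, the conic relation and `∑ Q_i = 0` force the determinant of the
quadratics to be zero (`quadDet_eq_zero_of_residual`). If two quadratics share a root, a Möbius
change of variable reduces to a normal form with the same conclusion
(`det_eq_zero_of_common_factor`). Either way linear independence is contradicted
(`not_isVanishingQuadruple`).

Now let `f` equal `G` on `K` and `x ^ d` elsewhere. Both pieces are injective and `x ^ d` preserves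
`K` and its complement, so `f` is a permutation. If `a, b ∈ K`, Frobenius and APN-ness confine the
solutions of the derivative equation to `K`, giving exactly the count for `G`. If `a ∈ K` and `b ∉
K` there are at most 2 solutions; if `a ∉ K`, at most 2 + 1 + 1. Hence `δ_G ≤ δ_f ≤ max 4 δ_G`, and
`δ_G` is the uniformity of `x ^ (2 ^ m - 1)` by affine invariance. -/

/-- The resultant of two quadratic polynomials, in characteristic two. -/
def quadRes {M : Type*} [CommRing M] (u v w u' v' w' : M) : M :=
  (u * w' + u' * w) ^ 2 + (u * v' + u' * v) * (v * w' + v' * w)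

/-! ### Polynomials of small degree vanishing at five points -/

section Roots

variable {M : Type*} [Field M]

/-- The polynomial vanishing at distinct points is a multiple of the product of the linear factors. -/
theorem exists_eq_prod_X_sub_C_mul {ι : Type*} [Fintype ι] {t : ι → M}
    (ht : Function.Injective t) {p : M[X]} (hp : ∀ j, p.eval (t j) = 0) :
    ∃ l : M[X], p = (∏ j, (X - C (t j))) * l :=
  Finset.prod_dvd_of_coprime (fun _ _ _ _ h => pairwise_coprime_X_sub_C ht h)
    fun j _ => dvd_iff_isRoot.2 (hp j)

theorem exists_linear_cofactor {ι : Type*} [Fintype ι] (hι : Fintype.card ι = 5) {t : ι → M}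
    (ht : Function.Injective t) {p : M[X]} (hp : ∀ j, p.eval (t j) = 0) (hd : p.natDegree ≤ 6) :
    ∃ e f : M, (∀ r, p.eval r = (∏ j, (r - t j)) * (e * r + f)) ∧ p.coeff 6 = e := by
  obtain ⟨l, rfl⟩ := exists_eq_prod_X_sub_C_mul ht hp
  set P : M[X] := ∏ j, (X - C (t j)) with hP
  have hmon : P.Monic := monic_prod_of_monic _ _ fun j _ => monic_X_sub_C _
  have hdeg : P.natDegree = 5 := by
    rw [hP, natDegree_prod_of_monic _ _ fun j _ => monic_X_sub_C _]
    simp [hι]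
  have hl : l.natDegree ≤ 1 := by
    rcases eq_or_ne l 0 with rfl | h0
    · simp
    · rw [hmon.natDegree_mul' h0, hdeg] at hd
      omega
  refine ⟨l.coeff 1, l.coeff 0, fun r => ?_, ?_⟩
  · conv_lhs => rw [eq_X_add_C_of_natDegree_le_one hl]
    simp [hP, eval_prod]
  · rw [show (6 : ℕ) = 5 + 1 from rfl, coeff_mul_add_eq_of_natDegree_le hdeg.le hl, ← hdeg,
      hmon.coeff_natDegree, one_mul]

theorem exists_const_cofactor {ι : Type*} [Fintype ι] (hι : Fintype.card ι = 5) {t : ι → M}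
    (ht : Function.Injective t) {p : M[X]} (hp : ∀ j, p.eval (t j) = 0) (hd : p.natDegree ≤ 5) :
    p = C (p.coeff 5) * ∏ j, (X - C (t j)) := by
  obtain ⟨l, rfl⟩ := exists_eq_prod_X_sub_C_mul ht hp
  set P : M[X] := ∏ j, (X - C (t j)) with hP
  have hmon : P.Monic := monic_prod_of_monic _ _ fun j _ => monic_X_sub_C _
  have hdeg : P.natDegree = 5 := by
    rw [hP, natDegree_prod_of_monic _ _ fun j _ => monic_X_sub_C _]
    simp [hι]
  have hl : l.natDegree ≤ 0 := by
    rcases eq_or_ne l 0 with rfl | h0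
    · simp
    · rw [hmon.natDegree_mul' h0, hdeg] at hd
      omega
  rw [show (P * l).coeff 5 = l.coeff 0 by
    rw [show (5 : ℕ) = 5 + 0 from rfl, coeff_mul_add_eq_of_natDegree_le hdeg.le hl, ← hdeg,
      hmon.coeff_natDegree, one_mul], ← eq_C_of_natDegree_le_zero hl, mul_comm]

end Roots

/-! ### Resultants of quadratics and the conic they trace -/

section Quadratic

variable {M : Type*} [Field M] [CharP M 2]

theorem exists_quadratic_roots [IsAlgClosed M] {u : M} (hu : u ≠ 0) (v w : M) :
    ∃ r s : M, v = u * (r + s) ∧ w = u * r * s := by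
  obtain ⟨r, hr⟩ := IsAlgClosed.exists_root (C u * X ^ 2 + C v * X + C w)
    (by rw [degree_quadratic hu]; decide)
  have hr' : u * r ^ 2 + v * r + w = 0 := by simpa [IsRoot] using hr
  refine ⟨r, v / u + r, ?_, ?_⟩
  · field_simp
    grind
  · field_simp
    grind

theorem quadRes_of_roots (u r s u' v' w' : M) :
    quadRes u (u * (r + s)) (u * r * s) u' v' w' =
      u ^ 2 * (u' * r ^ 2 + v' * r + w') * (u' * s ^ 2 + v' * s + w') := by
  unfold quadRes
  grind

/-- Multiplicativity of the resultant for `q₁` against a sextic that is congruent to `α q₂ q₃ q₄`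
modulo `q₁` and factors as `∏ (T - t j) * (e T + f)`. -/
theorem eval_residual_eq_quadRes_mul [IsAlgClosed M] {ι : Type*} [Fintype ι]
    (hι : Fintype.card ι = 5) (t : ι → M)
    (u₁ v₁ w₁ u₂ v₂ w₂ u₃ v₃ w₃ u₄ v₄ w₄ α e f : M) (hα : α ≠ 0)
    (hN : ∏ j, (u₁ * t j ^ 2 + v₁ * t j + w₁) = α ^ 2)
    (hS : ∀ r, u₁ * r ^ 2 + v₁ * r + w₁ = 0 →
      α * ((u₂ * r ^ 2 + v₂ * r + w₂) * (u₃ * r ^ 2 + v₃ * r + w₃) *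
        (u₄ * r ^ 2 + v₄ * r + w₄)) = (∏ j, (r - t j)) * (e * r + f))
    (hS' : u₁ = 0 → α * (u₂ * u₃ * u₄) = e) :
    u₁ * f ^ 2 + v₁ * f * e + w₁ * e ^ 2 =
      quadRes u₁ v₁ w₁ u₂ v₂ w₂ * quadRes u₁ v₁ w₁ u₃ v₃ w₃ * quadRes u₁ v₁ w₁ u₄ v₄ w₄ := by
  have hα2 : α ^ 2 ≠ 0 := pow_ne_zero _ hα
  apply mul_left_cancel₀ hα2
  -- Roots of the first quadratic may lie at infinity, where the sextic takes the value `e`: two of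
  -- them if `u₁ = v₁ = 0`, one if only `u₁ = 0`.
  by_cases hu : u₁ = 0
  · subst hu
    have he := hS' rfl
    by_cases hv : v₁ = 0
    · subst hv
      have hN' : w₁ ^ 5 = α ^ 2 := by simpa [hι] using hN
      unfold quadRes
      grind
    · set r := w₁ / v₁ with hr
      have hw : w₁ = v₁ * r := by rw [hr]; field_simp
      have hN' : v₁ ^ 5 * ∏ j, (r - t j) = α ^ 2 := by
        rw [← hN, ← hι, ← Finset.card_univ, ← Finset.prod_const, ← Finset.prod_mul_distrib]
        refine Finset.prod_congr rfl fun j _ => ?_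
        rw [hw]
        grind
      have h := hS r (by rw [hw]; grind)
      generalize ∏ j, (r - t j) = p at *
      rw [hw]
      unfold quadRes
      calc α ^ 2 * (0 * f ^ 2 + v₁ * f * e + v₁ * r * e ^ 2)
          = v₁ ^ 6 * e * (p * (e * r + f)) := by rw [← hN']; ring
        _ = α ^ 2 * ((v₁ ^ 2 * u₂ * (u₂ * r ^ 2 + v₂ * r + w₂)) *
            (v₁ ^ 2 * u₃ * (u₃ * r ^ 2 + v₃ * r + w₃)) *
            (v₁ ^ 2 * u₄ * (u₄ * r ^ 2 + v₄ * r + w₄))) := by rw [← h, ← he]; ring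
        _ = _ := by
          congr 1
          congr 1
          · congr 1 <;> grind
          · grind
  · obtain ⟨r, s, rfl, rfl⟩ := exists_quadratic_roots hu v₁ w₁
    have hN' : u₁ ^ 5 * ((∏ j, (r - t j)) * ∏ j, (s - t j)) = α ^ 2 := by
      rw [← hN, ← hι, ← Finset.card_univ, ← Finset.prod_const, ← Finset.prod_mul_distrib,
        ← Finset.prod_mul_distrib]
      refine Finset.prod_congr rfl fun j _ => ?_
      grind
    have hr := hS r (by grind)
    have hs := hS s (by grind)
    simp only [quadRes_of_roots]
    generalize ∏ j, (r - t j) = p at *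
    generalize ∏ j, (s - t j) = p' at *
    calc α ^ 2 * (u₁ * f ^ 2 + u₁ * (r + s) * f * e + u₁ * r * s * e ^ 2)
        = u₁ ^ 6 * (p * (e * r + f)) * (p' * (e * s + f)) := by rw [← hN']; ring
      _ = _ := by rw [← hr, ← hs]; ring

/-- The determinant of three quadratic polynomials, in characteristic two. -/
def quadDet (u v w : Fin 4 → M) : M :=
  u 0 * (v 1 * w 2 + v 2 * w 1) + v 0 * (u 1 * w 2 + u 2 * w 1) + w 0 * (u 1 * v 2 + u 2 * v 1)

/-- The left side is the equation of the conic traced by three quadratics. When `x, y, z` are their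
values at `(f : e)`, Cramer's rule turns the three linear forms on the right into `D f e`, `D e²`,
`D f²`, so the right side vanishes in characteristic two. -/
theorem quadRes_conic_identity (u₀ v₀ w₀ u₁ v₁ w₁ u₂ v₂ w₂ x y z : M) :
    quadRes u₁ v₁ w₁ u₂ v₂ w₂ * x ^ 2 + quadRes u₀ v₀ w₀ u₂ v₂ w₂ * y ^ 2
      + quadRes u₀ v₀ w₀ u₁ v₁ w₁ * z ^ 2
      + (u₀ * (v₁ * w₂ + v₂ * w₁) + v₀ * (u₁ * w₂ + u₂ * w₁) + w₀ * (u₁ * v₂ + u₂ * v₁)) *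
        (v₂ * x * y + v₁ * x * z + v₀ * y * z) =
    (x * (u₁ * w₂ + u₂ * w₁) + y * (u₀ * w₂ + u₂ * w₀) + z * (u₀ * w₁ + u₁ * w₀)) ^ 2 +
    (x * (u₁ * v₂ + u₂ * v₁) + y * (u₀ * v₂ + u₂ * v₀) + z * (u₀ * v₁ + u₁ * v₀)) *
    (x * (v₁ * w₂ + v₂ * w₁) + y * (v₀ * w₂ + v₂ * w₀) + z * (v₀ * w₁ + v₁ * w₀)) := by
  unfold quadRes
  grind

/-- Here `A, B, C` stand for the resultants among the first three quadratics and `r₀, r₁, r₂` for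
those with the fourth. Substituting the products of resultants into the conic makes the sum of all
six resultants a factor. -/
theorem conic_eval_residual (A B C b₀ b₁ b₂ r₀ r₁ r₂ : M)
    (h₀ : r₀ = A + B + b₀) (h₁ : r₁ = A + C + b₁) (h₂ : r₂ = B + C + b₂)
    (hs : A * B * r₀ + A * C * r₁ + B * C * r₂ + r₀ * r₁ * r₂ = 0)
    (hc : C * (A * B * r₀) ^ 2 + B * (A * C * r₁) ^ 2 + A * (B * C * r₂) ^ 2
      + (b₂ * (A * B * r₀) * (A * C * r₁) + b₁ * (A * B * r₀) * (B * C * r₂)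
      + b₀ * (A * C * r₁) * (B * C * r₂)) = 0) :
    A * B * C * r₀ * r₁ * r₂ * (A + B + C + r₀ + r₁ + r₂) = 0 := by
  have e₀ : b₀ = A + B + r₀ := by grind
  have e₁ : b₁ = A + C + r₁ := by grind
  have e₂ : b₂ = B + C + r₂ := by grind
  subst e₀ e₁ e₂
  clear h₀ h₁ h₂
  have hx : ∀ x y z t : M, x + y + z + t = 0 →
      C * x ^ 2 + B * y ^ 2 + A * z ^ 2 + ((B + C + r₂) * x * y + (A + C + r₁) * x * z
        + (A + B + r₀) * y * z) =
      A * z * t + B * y * t + C * x * t + r₀ * y * z + r₁ * x * z + r₂ * x * y := by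
    intro x y z t h
    have : t = x + y + z := by grind
    subst this
    clear hs hc h
    grind
  rw [hx _ _ _ _ hs] at hc
  rw [← hc]
  ring

/-- For `b i = D * v i` the right side is `D²` times an expression that itself equals `D²`; this is
how `D ^ 4 = 0` arises. -/
theorem sum_residual_eq_disc (A B C b₀ b₁ b₂ : M) (h : A + B + C + b₀ + b₁ + b₂ = 0) :
    A * B * (A + B + b₀) + A * C * (A + C + b₁) + B * C * (B + C + b₂)
      + (A + B + b₀) * (A + C + b₁) * (B + C + b₂) =
    A * b₂ ^ 2 + B * b₁ ^ 2 + C * b₀ ^ 2 + b₀ * b₁ * b₂ := by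
  grind

/-- If the values of the quadratics at a point are the products of their resultants, the quadratics
are linearly dependent. -/
theorem quadDet_eq_zero_of_residual (u v w : Fin 4 → M) (e f : M)
    (hu : ∑ i, u i = 0) (hv : ∑ i, v i = 0) (hw : ∑ i, w i = 0) (ρ : Fin 4 → Fin 4 → M)
    (hρ : ∀ i j, ρ i j = quadRes (u i) (v i) (w i) (u j) (v j) (w j))
    (hρ0 : ∀ i j, i ≠ j → ρ i j ≠ 0)
    (h0 : u 0 * f ^ 2 + v 0 * f * e + w 0 * e ^ 2 = ρ 0 1 * ρ 0 2 * ρ 0 3)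
    (h1 : u 1 * f ^ 2 + v 1 * f * e + w 1 * e ^ 2 = ρ 0 1 * ρ 1 2 * ρ 1 3)
    (h2 : u 2 * f ^ 2 + v 2 * f * e + w 2 * e ^ 2 = ρ 0 2 * ρ 1 2 * ρ 2 3)
    (h3 : u 3 * f ^ 2 + v 3 * f * e + w 3 * e ^ 2 = ρ 0 3 * ρ 1 3 * ρ 2 3) :
    quadDet u v w = 0 := by
  rw [Fin.sum_univ_four] at hu hv hw
  set D := quadDet u v w with hD
  have hu3 : u 3 = u 0 + u 1 + u 2 := by grind
  have hv3 : v 3 = v 0 + v 1 + v 2 := by grind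
  have hw3 : w 3 = w 0 + w 1 + w 2 := by grind
  have r03 : ρ 0 3 = ρ 0 1 + ρ 0 2 + D * v 0 := by
    simp only [hρ, hD, quadRes, quadDet, hu3, hv3, hw3]; grind
  have r13 : ρ 1 3 = ρ 0 1 + ρ 1 2 + D * v 1 := by
    simp only [hρ, hD, quadRes, quadDet, hu3, hv3, hw3]; grind
  have r23 : ρ 2 3 = ρ 0 2 + ρ 1 2 + D * v 2 := by
    simp only [hρ, hD, quadRes, quadDet, hu3, hv3, hw3]; grind
  have hdisc : D ^ 2 = ρ 0 1 * v 2 ^ 2 + ρ 0 2 * v 1 ^ 2 + ρ 1 2 * v 0 ^ 2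
      + D * v 0 * v 1 * v 2 := by
    simp only [hρ, hD, quadRes, quadDet]; grind
  have hconic : ∀ x y z : M, x = u 0 * f ^ 2 + v 0 * f * e + w 0 * e ^ 2 →
      y = u 1 * f ^ 2 + v 1 * f * e + w 1 * e ^ 2 →
      z = u 2 * f ^ 2 + v 2 * f * e + w 2 * e ^ 2 →
      ρ 1 2 * x ^ 2 + ρ 0 2 * y ^ 2 + ρ 0 1 * z ^ 2
        + D * (v 2 * x * y + v 1 * x * z + v 0 * y * z) = 0 := by
    intro x y z hx hy hz
    have e1 : x * (u 1 * v 2 + u 2 * v 1) + y * (u 0 * v 2 + u 2 * v 0)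
      + z * (u 0 * v 1 + u 1 * v 0) = D * e ^ 2 := by
      simp only [hx, hy, hz, hD, quadDet]; grind
    have e2 : x * (u 1 * w 2 + u 2 * w 1) + y * (u 0 * w 2 + u 2 * w 0)
      + z * (u 0 * w 1 + u 1 * w 0) = D * (f * e) := by
      simp only [hx, hy, hz, hD, quadDet]; grind
    have e3 : x * (v 1 * w 2 + v 2 * w 1) + y * (v 0 * w 2 + v 2 * w 0)
      + z * (v 0 * w 1 + v 1 * w 0) = D * f ^ 2 := by
      simp only [hx, hy, hz, hD, quadDet]; grind
    have e4 : (D * (f * e)) ^ 2 + (D * e ^ 2) * (D * f ^ 2) = 0 := by grind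
    rw [← e1, ← e2, ← e3, ← quadRes_conic_identity] at e4
    simpa only [hρ, hD, quadDet] using e4
  have hc := hconic _ _ _ rfl rfl rfl
  have hsum : ρ 0 1 * ρ 0 2 * ρ 0 3 + ρ 0 1 * ρ 1 2 * ρ 1 3 + ρ 0 2 * ρ 1 2 * ρ 2 3
      + ρ 0 3 * ρ 1 3 * ρ 2 3 = 0 := by
    rw [← h0, ← h1, ← h2, ← h3, hu3, hv3, hw3]; grind
  rw [h0, h1, h2] at hc
  have n01 := hρ0 0 1 (by decide)
  have n02 := hρ0 0 2 (by decide)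
  have n12 := hρ0 1 2 (by decide)
  have n03 := hρ0 0 3 (by decide)
  have n13 := hρ0 1 3 (by decide)
  have n23 := hρ0 2 3 (by decide)
  have hs : ρ 0 1 + ρ 0 2 + ρ 1 2 + ρ 0 3 + ρ 1 3 + ρ 2 3 = 0 := by
    have := conic_eval_residual _ _ _ (D * v 0) (D * v 1) (D * v 2) _ _ _ r03 r13 r23 hsum
      (by rw [← hc]; ring)
    simpa [n01, n02, n12, n03, n13, n23] using this
  have hs' : ρ 0 1 + ρ 0 2 + ρ 1 2 + D * v 0 + D * v 1 + D * v 2 = 0 := by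
    rw [r03, r13, r23] at hs
    rw [← hs]
    generalize ρ 0 1 = A, ρ 0 2 = B, ρ 1 2 = C, D * v 0 = b₀, D * v 1 = b₁, D * v 2 = b₂
    clear * -
    grind
  have : D ^ 4 = 0 := by
    rw [r03, r13, r23, sum_residual_eq_disc _ _ _ _ _ _ hs'] at hsum
    rw [← hsum, show D ^ 4 = D ^ 2 * D ^ 2 by ring]
    nth_rw 2 [hdisc]
    ring
  exact pow_eq_zero_iff (by norm_num) |>.1 this

end Quadratic

section Roots

variable {M : Type*} [Field M]

theorem quintic_eq_mul_prod {ι : Type*} [Fintype ι] (hι : Fintype.card ι = 5) {t : ι → M}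
    (ht : Function.Injective t) (c₅ c₄ c₃ c₂ c₁ c₀ : M)
    (h : ∀ j, c₅ * t j ^ 5 + c₄ * t j ^ 4 + c₃ * t j ^ 3 + c₂ * t j ^ 2 + c₁ * t j + c₀ = 0) :
    (∀ r, c₅ * r ^ 5 + c₄ * r ^ 4 + c₃ * r ^ 3 + c₂ * r ^ 2 + c₁ * r + c₀ =
      c₅ * ∏ j, (r - t j)) ∧
    (c₅ = 0 → c₄ = 0 ∧ c₃ = 0 ∧ c₂ = 0 ∧ c₁ = 0 ∧ c₀ = 0) := by
  set p : M[X] := C c₅ * X ^ 5 + C c₄ * X ^ 4 + C c₃ * X ^ 3 + C c₂ * X ^ 2 + C c₁ * X + C c₀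
    with hp
  have hd : p.natDegree ≤ 5 := by rw [hp]; compute_degree
  have hev : ∀ r, p.eval r =
      c₅ * r ^ 5 + c₄ * r ^ 4 + c₃ * r ^ 3 + c₂ * r ^ 2 + c₁ * r + c₀ := by
    intro r; simp [hp]
  have hc : ∀ n, p.coeff n = if n = 5 then c₅ else if n = 4 then c₄ else if n = 3 then c₃ else
      if n = 2 then c₂ else if n = 1 then c₁ else if n = 0 then c₀ else 0 := by
    intro n
    simp only [hp, coeff_add, coeff_C_mul, coeff_X_pow, coeff_X, coeff_C]
    rcases n with _ | _ | _ | _ | _ | _ | n <;> simp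
  have hfac := exists_const_cofactor hι ht (p := p) (fun j => by rw [hev, h]) hd
  have h5 : p.coeff 5 = c₅ := by simp [hc]
  refine ⟨fun r => ?_, fun h0 => ?_⟩
  · rw [← hev, hfac, h5]
    simp [eval_prod]
  · rw [h5, h0, C_0, zero_mul] at hfac
    have hz : ∀ n, p.coeff n = 0 := by simp [hfac]
    exact ⟨by simpa [hc] using hz 4, by simpa [hc] using hz 3, by simpa [hc] using hz 2,
      by simpa [hc] using hz 1, by simpa [hc] using hz 0⟩

end Roots

/-! ### Two quadratics with a common root, in normal form -/

section Degenerate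

variable {M : Type*} [Field M] [CharP M 2]

theorem eq_of_sq_eq_sq_charTwo {a b : M} (h : a ^ 2 = b ^ 2) : a = b := by
  have : (a + b) ^ 2 = 0 := by grind
  have := pow_eq_zero_iff (two_ne_zero) |>.1 this
  grind

/-- The subcase where the quintic of `det_eq_zero_of_common_factor` vanishes identically and the
third quadratic has root zero. The coefficient relations exclude `u = 0`; for `u = l₁` they combine
with the norm conditions to force `v = l₀`. -/
theorem det_eq_zero_of_vanishing_of_root_zero {ι : Type*} [Fintype ι] (hι : Fintype.card ι = 5)
    (t : ι → M) (l₁ l₀ u v a₁ a₂ a₃ a₄ : M)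
    (hl₁ : l₁ ≠ 0) (hl₀ : l₀ ≠ 0) (ha₂ : a₂ ≠ 0) (ha₃ : a₃ ≠ 0) (ha₄ : a₄ ≠ 0)
    (hl : a₁ * l₁ = a₂ * l₀) (hu : u * (u + l₁) = 0)
    (e₃ : a₂ * (u * (v + l₀ + l₁) + v * (u + l₁)) + l₁ * (a₃ * (u + l₁) + a₄ * u) = 0)
    (e₂ : a₂ * (u * l₀ + v * (v + l₀ + l₁)) + l₁ * (a₃ * (v + l₀ + l₁) + a₄ * v) = 0)
    (e₁ : a₂ * v + l₁ * a₃ = 0)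
    (h₁ : ∏ j, (t j * (l₁ * t j + l₀)) = a₁ ^ 2) (h₂ : ∏ j, (l₁ * t j + l₀) = a₂ ^ 2)
    (h₃ : ∏ j, (u * t j ^ 2 + v * t j) = a₃ ^ 2)
    (h₄ : ∏ j, ((u + l₁) * t j ^ 2 + (v + l₀ + l₁) * t j + l₀) = a₄ ^ 2) :
    u * l₀ ^ 2 + v * l₀ * l₁ = 0 := by
  have hv : v ≠ 0 := by
    rintro rfl
    have : l₁ * a₃ = 0 := by simpa using e₁
    simp_all
  rcases mul_eq_zero.1 hu with rfl | hu'
  · exfalso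
    have : l₁ * a₄ * v = 0 := by
      clear h₁ h₂ h₃ h₄ e₃
      linear_combination e₂ - (v + l₀ + l₁) * e₁
    simp_all
  · have hul : u = l₁ := by grind
    subst hul
    obtain ⟨v', hv'⟩ : ∃ v', v' = v + l₀ + u := ⟨_, rfl⟩
    rw [← hv'] at e₂ e₃ h₄
    rw [hu'] at e₃ h₄
    have e₄ : a₂ * v' + u * a₄ = 0 := by
      apply mul_left_cancel₀ hl₁
      linear_combination e₃
    have hvv : v * v' = u * l₀ := by
      apply mul_left_cancel₀ ha₂
      clear h₁ h₂ h₃ h₄ hu hv' e₃ hu' hl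
      grind
    have hn : (∏ j, t j) * u ^ 2 = l₀ ^ 2 := by
      rw [Finset.prod_mul_distrib, h₂] at h₁
      apply mul_left_cancel₀ (pow_ne_zero 2 ha₂)
      linear_combination u ^ 2 * h₁ + (a₁ * u + a₂ * l₀) * hl
    -- The fourth quadratic has lost its leading term, and `hvv` makes the remaining linear form
    -- proportional to `u T + v`, the cofactor of `T` in the third.
    have hM : v ^ 5 * a₄ ^ 2 = l₀ ^ 5 * ∏ j, (u * t j + v) := by
      rw [← h₄, ← hι, ← Finset.card_univ, ← Finset.prod_const, ← Finset.prod_const,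
        ← Finset.prod_mul_distrib, ← Finset.prod_mul_distrib]
      refine Finset.prod_congr rfl fun j _ => ?_
      linear_combination t j * hvv
    have h₃' : (∏ j, t j) * ∏ j, (u * t j + v) = a₃ ^ 2 := by
      rw [← h₃, ← Finset.prod_mul_distrib]
      refine Finset.prod_congr rfl fun j _ => ?_
      ring
    generalize ∏ j, t j = n at *
    generalize ∏ j, (u * t j + v) = m at *
    have hfin : a₂ ^ 2 * u ^ 2 * l₀ ^ 4 * v ^ 2 * (v - l₀) = 0 := by
      have k₁ : n * v ^ 5 * a₄ ^ 2 = l₀ ^ 5 * a₃ ^ 2 := by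
        linear_combination n * hM + l₀ ^ 5 * h₃'
      have k₂ : u * a₃ = a₂ * v := by grind
      have k₃ : u * a₄ = a₂ * v' := by grind
      have k₄ : n * v ^ 5 * (u * a₄) ^ 2 = l₀ ^ 5 * (u * a₃) ^ 2 := by
        linear_combination u ^ 2 * k₁
      rw [k₂, k₃] at k₄
      have k₅ : (n * u ^ 2) * v ^ 3 * a₂ ^ 2 * (v * v') ^ 2 = l₀ ^ 5 * (a₂ * v) ^ 2 * u ^ 2 := by
        linear_combination u ^ 2 * k₄
      rw [hn, hvv] at k₅
      linear_combination k₅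
    have : v = l₀ := by
      simpa [ha₂, hl₁, hl₀, hv, sub_eq_zero] using hfin
    subst this
    clear * -
    grind

/-- Multiply the values of the quintic at the two roots of `u T² + v T + w`: the products over `t`
combine to `a²`, and the factors `l₁ T + l₀`, `T`, `T + 1` give the resultant with the linear form
and the values at 0 and 1. -/
theorem sq_leadingCoeff_eq_of_residual [IsAlgClosed M] {ι : Type*} [Fintype ι]
    (hι : Fintype.card ι = 5) (t : ι → M) (l₁ l₀ u v w a e : M) (ha : a ≠ 0) (hu : u ≠ 0)
    (hN : ∏ j, (u * t j ^ 2 + v * t j + w) = a ^ 2)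
    (hP : ∀ r, u * r ^ 2 + v * r + w = 0 →
      (l₁ * r + l₀) * r * (a * ((r + 1) * (l₁ * r + l₀))) = e * ∏ j, (r - t j)) :
    e ^ 2 = (u * l₀ ^ 2 + v * l₀ * l₁ + w * l₁ ^ 2) ^ 2 * (u * w) * (u + v + w) := by
  obtain ⟨r, s, rfl, rfl⟩ := exists_quadratic_roots hu v w
  have hN' : u ^ 5 * ((∏ j, (r - t j)) * ∏ j, (s - t j)) = a ^ 2 := by
    rw [← hN, ← hι, ← Finset.card_univ, ← Finset.prod_const, ← Finset.prod_mul_distrib,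
      ← Finset.prod_mul_distrib]
    refine Finset.prod_congr rfl fun j _ => ?_
    grind
  have hr := hP r (by grind)
  have hs := hP s (by grind)
  generalize ∏ j, (r - t j) = p at *
  generalize ∏ j, (s - t j) = p' at *
  apply mul_left_cancel₀ (pow_ne_zero 2 ha)
  calc a ^ 2 * e ^ 2 = u ^ 5 * ((e * p) * (e * p')) := by rw [← hN']; ring
    _ = _ := by rw [← hr, ← hs]; ring

/-- `A, C` are the constant and leading coefficients of the third quadratic, `B, D` those of the
fourth. Comparing `h₃` with `h₄` gives `C A = D B`; the other values then give `v = B + D`, and with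
these `g` vanishes. -/
theorem false_of_residual_invariants (A B C D v l₁ l₀ g a₁ a₂ n : M)
    (ha₁ : a₁ ≠ 0) (ha₂ : a₂ ≠ 0)
    (hC : C ≠ 0) (hD : D ≠ 0) (hB : B = A + l₀) (hD' : D = C + l₁)
    (hg : g = C * l₀ ^ 2 + v * l₀ * l₁ + A * l₁ ^ 2) (hg0 : g ≠ 0)
    (hn : n * a₂ ^ 2 = a₁ ^ 2) (h₀ : a₁ * (A * B) = a₂ * (C * D) * n)
    (hl : a₂ * (C * D) * a₂ ^ 2 = (a₁ * l₁ + a₂ * l₀) * g ^ 2)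
    (h₃ : (a₂ * (C * D)) ^ 2 = g ^ 2 * (C * A) * (C + v + A))
    (h₄ : (a₂ * (C * D)) ^ 2 = g ^ 2 * (D * B) * (C + v + A)) : False := by
  have hL : (a₂ * (C * D)) ^ 2 ≠ 0 := pow_ne_zero _ (mul_ne_zero ha₂ (mul_ne_zero hC hD))
  have hσ : C + v + A ≠ 0 := by
    intro h
    rw [h, mul_zero] at h₃
    exact hL h₃
  have hA : A ≠ 0 := by
    rintro rfl
    simp only [mul_zero, zero_mul] at h₃
    exact hL h₃
  have hAC : C * A = D * B := by
    rw [h₃] at h₄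
    exact mul_left_cancel₀ (pow_ne_zero 2 hg0) (mul_right_cancel₀ hσ h₄)
  have hα : a₁ * (C * D) = a₂ * (A * B) := by
    apply mul_left_cancel₀ ha₁
    linear_combination (-(C * D)) * hn - a₂ * h₀
  have hσ' : C * A * (C + v + A) = (A * B) * l₁ + (C * D) * l₀ := by
    apply mul_left_cancel₀ (pow_ne_zero 2 hg0)
    apply mul_left_cancel₀ ha₂
    linear_combination (-a₂) * h₃ + (C * D) * hl + g ^ 2 * l₁ * hα
  have e₁ : l₁ = C + D := by grind
  have e₀ : l₀ = A + B := by grind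
  have hv : v = B + D := by
    have : C * A * (C + v + A) = C * A * (A + B + C + D) := by
      rw [hσ', e₁, e₀]
      clear hσ' hα h₃ h₄ hl h₀ hn hg hB hD' e₁ e₀
      grind
    have := mul_left_cancel₀ (mul_ne_zero hC hA) this
    clear hσ' hα h₃ h₄ hl h₀ hn hg hB hD' e₁ e₀
    grind
  apply hg0
  rw [hg, hv, e₁, e₀]
  clear hσ' hα h₃ h₄ hl h₀ hn hg hB hD' e₁ e₀ hσ hg0
  grind

/-- With `l = l₁ T + l₀`, the normal form is `T l, l, Q, Q + (T + 1) l`. Cancelling the shared `l`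
lowers the sextic to a quintic, which is its leading coefficient times `∏ (T - t j)`. Its values at
0 and at the roots of `l`, `Q` and the fourth quadratic overdetermine the configuration unless `l`
divides `Q` in the homogeneous sense. -/
theorem det_eq_zero_of_common_factor [IsAlgClosed M] {ι : Type*} [Fintype ι]
    (hι : Fintype.card ι = 5) (t : ι → M) (ht : Function.Injective t)
    (l₁ l₀ u v w a₁ a₂ a₃ a₄ : M)
    (ha₁ : a₁ ≠ 0) (ha₂ : a₂ ≠ 0) (ha₃ : a₃ ≠ 0) (ha₄ : a₄ ≠ 0)
    (h₁ : ∏ j, (t j * (l₁ * t j + l₀)) = a₁ ^ 2) (h₂ : ∏ j, (l₁ * t j + l₀) = a₂ ^ 2)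
    (h₃ : ∏ j, (u * t j ^ 2 + v * t j + w) = a₃ ^ 2)
    (h₄ : ∏ j, ((u + l₁) * t j ^ 2 + (v + l₀ + l₁) * t j + (w + l₀)) = a₄ ^ 2)
    (hE : ∀ j, (a₁ + a₂ * t j) * (u * t j ^ 2 + v * t j + w) *
        ((u + l₁) * t j ^ 2 + (v + l₀ + l₁) * t j + (w + l₀)) + (l₁ * t j + l₀) * t j *
        (a₃ * ((u + l₁) * t j ^ 2 + (v + l₀ + l₁) * t j + (w + l₀)) +
          a₄ * (u * t j ^ 2 + v * t j + w)) = 0) :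
    u * l₀ ^ 2 + v * l₀ * l₁ + w * l₁ ^ 2 = 0 := by
  obtain ⟨u', hu'⟩ : ∃ u', u' = u + l₁ := ⟨_, rfl⟩
  obtain ⟨v', hv'⟩ : ∃ v', v' = v + l₀ + l₁ := ⟨_, rfl⟩
  obtain ⟨w', hw'⟩ : ∃ w', w' = w + l₀ := ⟨_, rfl⟩
  rw [← hu', ← hv', ← hw'] at h₄
  simp only [← hu', ← hv', ← hw'] at hE
  obtain ⟨hP, hP0⟩ := quintic_eq_mul_prod hι ht (a₂ * (u * u'))
    (a₁ * (u * u') + a₂ * (u * v' + v * u') + l₁ * (a₃ * u' + a₄ * u))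
    (a₁ * (u * v' + v * u') + a₂ * (u * w' + v * v' + w * u') + l₁ * (a₃ * v' + a₄ * v)
      + l₀ * (a₃ * u' + a₄ * u))
    (a₁ * (u * w' + v * v' + w * u') + a₂ * (v * w' + w * v') + l₁ * (a₃ * w' + a₄ * w)
      + l₀ * (a₃ * v' + a₄ * v))
    (a₁ * (v * w' + w * v') + a₂ * (w * w') + l₀ * (a₃ * w' + a₄ * w))
    (a₁ * (w * w')) (fun j => by rw [← hE j]; ring)
  have hP' : ∀ r, (a₁ + a₂ * r) * (u * r ^ 2 + v * r + w) * (u' * r ^ 2 + v' * r + w') +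
      (l₁ * r + l₀) * r * (a₃ * (u' * r ^ 2 + v' * r + w') + a₄ * (u * r ^ 2 + v * r + w)) =
      a₂ * (u * u') * ∏ j, (r - t j) := by
    intro r; rw [← hP r]; ring
  clear hP
  by_contra hg
  obtain ⟨g, hgdef⟩ : ∃ g, g = u * l₀ ^ 2 + v * l₀ * l₁ + w * l₁ ^ 2 := ⟨_, rfl⟩
  rw [← hgdef] at hg
  have hn : (∏ j, t j) * a₂ ^ 2 = a₁ ^ 2 := by
    rw [← h₁, Finset.prod_mul_distrib, h₂]
  have h₀ : a₁ * (w * w') = a₂ * (u * u') * ∏ j, t j := by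
    have := hP' 0
    simp only [zero_sub, CharTwo.neg_eq] at this
    rw [← this]
    ring
  have hg' : g = u' * l₀ ^ 2 + v' * l₀ * l₁ + w' * l₁ ^ 2 := by
    rw [hgdef, hu', hv', hw']
    clear * -
    grind
  -- The quintic evaluated at the root of `l₁ T + l₀`, which is at infinity when `l₁ = 0`.
  have hl : a₂ * (u * u') * a₂ ^ 2 = (a₁ * l₁ + a₂ * l₀) * g ^ 2 := by
    by_cases hl₁ : l₁ = 0
    · subst hl₁
      have : l₀ ^ 5 = a₂ ^ 2 := by simpa [hι] using h₂
      rw [← this, hgdef, hu']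
      ring
    · have hr : l₁ ^ 5 * ∏ j, (l₀ / l₁ - t j) = a₂ ^ 2 := by
        rw [← h₂, ← hι, ← Finset.card_univ, ← Finset.prod_const, ← Finset.prod_mul_distrib]
        refine Finset.prod_congr rfl fun j _ => ?_
        rw [CharTwo.sub_eq_add]
        field_simp
        ring
      rw [← hr, mul_left_comm, ← hP' (l₀ / l₁)]
      have k₁ : l₁ ^ 2 * (u * (l₀ / l₁) ^ 2 + v * (l₀ / l₁) + w) = g := by
        rw [hgdef]; field_simp
      have k₂ : l₁ ^ 2 * (u' * (l₀ / l₁) ^ 2 + v' * (l₀ / l₁) + w') = g := by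
        rw [hg']; field_simp
      have k₃ : l₁ * (l₀ / l₁) + l₀ = 0 := by
        rw [mul_div_cancel₀ _ hl₁]; exact CharTwo.add_self_eq_zero _
      have k₄ : l₁ * (a₁ + a₂ * (l₀ / l₁)) = a₁ * l₁ + a₂ * l₀ := by field_simp
      rw [k₃, sq g, ← k₄]
      nth_rw 1 [← k₁]
      rw [← k₂]
      ring
  by_cases hC : u * u' = 0
  -- The quintic is identically zero and, by `hl'`, `a₁ + a₂ T` is proportional to `l₁ T + l₀`.
  -- Dividing that factor out leaves the relations `e₁, e₂, e₃`. Then `w * w' = 0` gives two cases,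
  -- exchanged by swapping the last two quadratics.
  · obtain ⟨c₄, c₃, -, c₁, c₀⟩ := hP0 (by rw [hC, mul_zero])
    have hl' : a₁ * l₁ = a₂ * l₀ := by
      rw [hC] at hl
      have : a₁ * l₁ + a₂ * l₀ = 0 := by simpa [hg] using hl.symm
      exact CharTwo.add_eq_zero.1 this
    have hl₁ : l₁ ≠ 0 := by
      rintro rfl
      have : l₀ = 0 := by simpa [ha₂] using hl'.symm
      simp [hgdef, this] at hg
    have hl₀ : l₀ ≠ 0 := by
      rintro rfl
      simp [ha₁, hl₁] at hl'
    have e₃ : a₂ * (u * v' + v * u') + l₁ * (a₃ * u' + a₄ * u) = 0 := by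
      rw [hC] at c₄
      linear_combination c₄
    have hww : w * w' = 0 := by simpa [ha₁] using c₀
    have e₁ : a₂ * (v * w' + w * v') + l₁ * (a₃ * w' + a₄ * w) = 0 := by
      rw [hww] at c₁
      apply mul_left_cancel₀ hl₀
      linear_combination l₁ * c₁ - (v * w' + w * v') * hl'
    have e₂ : a₂ * (u * w' + v * v' + w * u') + l₁ * (a₃ * v' + a₄ * v) = 0 := by
      apply mul_left_cancel₀ hl₁
      linear_combination l₁ * c₃ - (u * v' + v * u') * hl' - l₀ * e₃
    rcases mul_eq_zero.1 hww with hw | hw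
    · subst hw
      have hw'' : w' = l₀ := by rw [hw', zero_add]
      subst hw''
      refine hg ?_
      rw [hgdef, zero_mul, add_zero]
      refine det_eq_zero_of_vanishing_of_root_zero hι t l₁ w' u v a₁ a₂ a₃ a₄ hl₁ hl₀ ha₂ ha₃ ha₄
        hl' (hu' ▸ hC) ?_ ?_ ?_ h₁ h₂ (by simpa using h₃) ?_
      · rw [← hu', ← hv']; exact e₃
      · rw [← hv']; linear_combination e₂
      · apply mul_left_cancel₀ hl₀
        linear_combination e₁
      · rw [← hu', ← hv']; exact h₄
    · subst hw
      have hw'' : w = l₀ := CharTwo.add_eq_zero.1 hw'.symm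
      subst hw''
      have hu2 : u = u' + l₁ := by rw [hu', add_assoc, CharTwo.add_self_eq_zero, add_zero]
      have hv2 : v = v' + w + l₁ := by
        rw [hv']
        clear * -
        grind
      refine hg ?_
      rw [hg', zero_mul, add_zero]
      refine det_eq_zero_of_vanishing_of_root_zero hι t l₁ w u' v' a₁ a₂ a₄ a₃ hl₁ hl₀ ha₂ ha₄ ha₃
        hl' ?_ ?_ ?_ ?_ h₁ h₂ (by simpa using h₄) ?_
      · rw [← hu2, mul_comm]; exact hC
      · rw [← hu2, ← hv2]; linear_combination e₃
      · rw [← hv2]; linear_combination e₂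
      · apply mul_left_cancel₀ hl₀
        linear_combination e₁
      · rw [← hu2, ← hv2]; exact h₃
  · have hu0 : u ≠ 0 := left_ne_zero_of_mul hC
    have hu0' : u' ≠ 0 := right_ne_zero_of_mul hC
    have hq : ∀ r, u' * r ^ 2 + v' * r + w' = u * r ^ 2 + v * r + w + (r + 1) * (l₁ * r + l₀) := by
      intro r
      rw [hu', hv', hw']
      ring
    have k₃ := sq_leadingCoeff_eq_of_residual hι t l₁ l₀ u v w a₃ (a₂ * (u * u')) ha₃ hu0 h₃
      (fun r hr => by rw [← hP', hq, hr]; ring)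
    have k₄ := sq_leadingCoeff_eq_of_residual hι t l₁ l₀ u' v' w' a₄ (a₂ * (u * u')) ha₄ hu0' h₄
      (fun r hr => by
        have h' := hq r
        rw [hr] at h'
        have : u * r ^ 2 + v * r + w = (r + 1) * (l₁ * r + l₀) := CharTwo.add_eq_zero.1 h'.symm
        rw [← hP', hr, this]; ring)
    rw [← hgdef] at k₃
    rw [← hg'] at k₄
    have hσ : u' + v' + w' = u + v + w := by
      rw [hu', hv', hw']
      clear * -
      grind
    rw [hσ] at k₄
    exact false_of_residual_invariants w w' u u' v l₁ l₀ g a₁ a₂ _ ha₁ ha₂ hu0 hu0' hw' hu' hgdef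
      hg hn h₀ hl k₃ k₄
end Degenerate

section Roots

variable {M : Type*} [Field M]

theorem natDegree_quadratic_mul_le (u₁ v₁ w₁ u₂ v₂ w₂ u₃ v₃ w₃ : M) :
    ((C u₁ * X ^ 2 + C v₁ * X + C w₁) * (C u₂ * X ^ 2 + C v₂ * X + C w₂) *
      (C u₃ * X ^ 2 + C v₃ * X + C w₃)).natDegree ≤ 6 ∧
    ((C u₁ * X ^ 2 + C v₁ * X + C w₁) * (C u₂ * X ^ 2 + C v₂ * X + C w₂) *
      (C u₃ * X ^ 2 + C v₃ * X + C w₃)).coeff 6 = u₁ * u₂ * u₃ := by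
  have hd : ∀ u v w : M, (C u * X ^ 2 + C v * X + C w).natDegree ≤ 2 :=
    fun u v w => natDegree_quadratic_le
  have hc : ∀ u v w : M, (C u * X ^ 2 + C v * X + C w).coeff 2 = u := by
    intro u v w; simp
  have h₂ := natDegree_mul_le_of_le (hd u₁ v₁ w₁) (hd u₂ v₂ w₂)
  refine ⟨natDegree_mul_le_of_le h₂ (hd u₃ v₃ w₃), ?_⟩
  rw [show (6 : ℕ) = 2 + 2 + 2 from rfl, coeff_mul_add_eq_of_natDegree_le h₂ (hd _ _ _),
    coeff_mul_add_eq_of_natDegree_le (hd _ _ _) (hd _ _ _), hc, hc, hc]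

end Roots

/-! ### Four quadratics of sum zero: the determinant vanishes -/

section Config

variable {M : Type*} [Field M] [CharP M 2]

theorem exists_common_linear_factor [IsAlgClosed M] {u₁ v₁ w₁ u₂ v₂ w₂ : M}
    (h : quadRes u₁ v₁ w₁ u₂ v₂ w₂ = 0) :
    ∃ l₁ l₀ c₁ b₁ c₂ b₂ : M, u₁ = c₁ * l₁ ∧ v₁ = c₁ * l₀ + b₁ * l₁ ∧ w₁ = b₁ * l₀ ∧
      u₂ = c₂ * l₁ ∧ v₂ = c₂ * l₀ + b₂ * l₁ ∧ w₂ = b₂ * l₀ := by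
  have key : ∀ u v w u' v' w' : M, quadRes u v w u' v' w' = 0 → u ≠ 0 →
      ∃ l₁ l₀ c₁ b₁ c₂ b₂ : M, u = c₁ * l₁ ∧ v = c₁ * l₀ + b₁ * l₁ ∧ w = b₁ * l₀ ∧
      u' = c₂ * l₁ ∧ v' = c₂ * l₀ + b₂ * l₁ ∧ w' = b₂ * l₀ := by
    intro u v w u' v' w' h hu
    obtain ⟨r, s, rfl, rfl⟩ := exists_quadratic_roots hu v w
    rw [quadRes_of_roots] at h
    have h' : u' * r ^ 2 + v' * r + w' = 0 ∨ u' * s ^ 2 + v' * s + w' = 0 := by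
      simpa [hu] using h
    rcases h' with h' | h'
    · refine ⟨1, r, u, u * s, u', v' + u' * r, ?_, ?_, ?_, ?_, ?_, ?_⟩ <;> grind
    · refine ⟨1, s, u, u * r, u', v' + u' * s, ?_, ?_, ?_, ?_, ?_, ?_⟩ <;> grind
  by_cases h₁ : u₁ = 0
  · by_cases h₂ : u₂ = 0
    -- The common root is at infinity, encoded by the linear form `0 * T + 1`.
    · exact ⟨0, 1, v₁, w₁, v₂, w₂, by simp [h₁], by simp, by simp, by simp [h₂], by simp, by simp⟩
    · obtain ⟨l₁, l₀, c₁, b₁, c₂, b₂, e₁, e₂, e₃, e₄, e₅, e₆⟩ := key u₂ v₂ w₂ u₁ v₁ w₁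
        (by rw [← h]; unfold quadRes; ring) h₂
      exact ⟨l₁, l₀, c₂, b₂, c₁, b₁, e₄, e₅, e₆, e₁, e₂, e₃⟩
  · exact key _ _ _ _ _ _ h h₁

theorem mobius_quadratic (u v w c₁ b₁ c₂ b₂ t : M) :
    (u * b₂ ^ 2 + v * b₂ * c₂ + w * c₂ ^ 2) * (c₁ * t + b₁) ^ 2
      + v * (c₁ * b₂ + c₂ * b₁) * (c₁ * t + b₁) * (c₂ * t + b₂)
      + (u * b₁ ^ 2 + v * b₁ * c₁ + w * c₁ ^ 2) * (c₂ * t + b₂) ^ 2 =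
    (c₁ * b₂ + c₂ * b₁) ^ 2 * (u * t ^ 2 + v * t + w) := by
  grind

theorem mobius_resultant (u v w c₁ b₁ c₂ b₂ l₁ l₀ : M) :
    (u * b₂ ^ 2 + v * b₂ * c₂ + w * c₂ ^ 2) * (l₁ * b₁ + l₀ * c₁) ^ 2
      + v * (c₁ * b₂ + c₂ * b₁) * (l₁ * b₁ + l₀ * c₁) * (l₁ * b₂ + l₀ * c₂)
      + (u * b₁ ^ 2 + v * b₁ * c₁ + w * c₁ ^ 2) * (l₁ * b₂ + l₀ * c₂) ^ 2 =
    (c₁ * b₂ + c₂ * b₁) ^ 2 * (u * l₀ ^ 2 + v * l₀ * l₁ + w * l₁ ^ 2) := by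
  grind

theorem mobius_linear (c₁ b₁ c₂ b₂ l₁ l₀ t : M) :
    (l₁ * b₂ + l₀ * c₂) * (c₁ * t + b₁) + (l₁ * b₁ + l₀ * c₁) * (c₂ * t + b₂) =
    (c₁ * b₂ + c₂ * b₁) * (l₁ * t + l₀) := by
  grind

/-- Write the first two quadratics as `k₁ l` and `k₂ l`. The determinant is `Res(k₁, k₂) * Res(l,
Q₃)`; if the first factor is nonzero, the variable `s = k₁ / k₂` is a Möbius coordinate in which the
configuration has the normal form of `det_eq_zero_of_common_factor`. -/
theorem det_eq_zero_of_quadRes_eq_zero [IsAlgClosed M] {ι : Type*} [Fintype ι]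
    (hι : Fintype.card ι = 5) (t : ι → M) (ht : Function.Injective t)
    (u₁ v₁ w₁ u₂ v₂ w₂ u₃ v₃ w₃ u₄ v₄ w₄ a₁ a₂ a₃ a₄ : M)
    (hu : u₁ + u₂ + u₃ + u₄ = 0) (hv : v₁ + v₂ + v₃ + v₄ = 0) (hw : w₁ + w₂ + w₃ + w₄ = 0)
    (ha₁ : a₁ ≠ 0) (ha₂ : a₂ ≠ 0) (ha₃ : a₃ ≠ 0) (ha₄ : a₄ ≠ 0)
    (h₁ : ∏ j, (u₁ * t j ^ 2 + v₁ * t j + w₁) = a₁ ^ 2)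
    (h₂ : ∏ j, (u₂ * t j ^ 2 + v₂ * t j + w₂) = a₂ ^ 2)
    (h₃ : ∏ j, (u₃ * t j ^ 2 + v₃ * t j + w₃) = a₃ ^ 2)
    (h₄ : ∏ j, (u₄ * t j ^ 2 + v₄ * t j + w₄) = a₄ ^ 2)
    (hE : ∀ j, a₁ / (u₁ * t j ^ 2 + v₁ * t j + w₁) + a₂ / (u₂ * t j ^ 2 + v₂ * t j + w₂) +
      a₃ / (u₃ * t j ^ 2 + v₃ * t j + w₃) + a₄ / (u₄ * t j ^ 2 + v₄ * t j + w₄) = 0)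
    (hres : quadRes u₁ v₁ w₁ u₂ v₂ w₂ = 0) :
    u₁ * (v₂ * w₃ + v₃ * w₂) + v₁ * (u₂ * w₃ + u₃ * w₂) + w₁ * (u₂ * v₃ + u₃ * v₂) = 0 := by
  obtain ⟨l₁, l₀, c₁, b₁, c₂, b₂, rfl, rfl, rfl, rfl, rfl, rfl⟩ := exists_common_linear_factor hres
  clear hres
  obtain ⟨d, hd⟩ : ∃ d, d = c₁ * b₂ + c₂ * b₁ := ⟨_, rfl⟩
  suffices d * (u₃ * l₀ ^ 2 + v₃ * l₀ * l₁ + w₃ * l₁ ^ 2) = 0 by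
    rw [← this, hd]
    clear * -
    grind
  by_cases hd0 : d = 0
  · rw [hd0, zero_mul]
  have hq₁ : ∀ x, c₁ * l₁ * x ^ 2 + (c₁ * l₀ + b₁ * l₁) * x + b₁ * l₀ =
      (c₁ * x + b₁) * (l₁ * x + l₀) := fun x => by ring
  have hq₂ : ∀ x, c₂ * l₁ * x ^ 2 + (c₂ * l₀ + b₂ * l₁) * x + b₂ * l₀ =
      (c₂ * x + b₂) * (l₁ * x + l₀) := fun x => by ring
  have hq₄ : ∀ x, u₄ * x ^ 2 + v₄ * x + w₄ = (c₁ * x + b₁) * (l₁ * x + l₀) +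
      (c₂ * x + b₂) * (l₁ * x + l₀) + (u₃ * x ^ 2 + v₃ * x + w₃) := fun x => by
    rw [← hq₁, ← hq₂]
    apply CharTwo.add_eq_zero.1
    linear_combination x ^ 2 * hu + x * hv + hw
  simp only [hq₁, hq₂, hq₄] at h₁ h₂ h₄ hE
  have n₂ : ∀ j, (c₂ * t j + b₂) * (l₁ * t j + l₀) ≠ 0 := fun j =>
    Finset.prod_ne_zero_iff.1 (h₂ ▸ pow_ne_zero 2 ha₂) j (Finset.mem_univ j)
  have n₁ : ∀ j, (c₁ * t j + b₁) * (l₁ * t j + l₀) ≠ 0 := fun j =>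
    Finset.prod_ne_zero_iff.1 (h₁ ▸ pow_ne_zero 2 ha₁) j (Finset.mem_univ j)
  have n₃ : ∀ j, u₃ * t j ^ 2 + v₃ * t j + w₃ ≠ 0 := fun j =>
    Finset.prod_ne_zero_iff.1 (h₃ ▸ pow_ne_zero 2 ha₃) j (Finset.mem_univ j)
  have n₄ : ∀ j, (c₁ * t j + b₁) * (l₁ * t j + l₀) +
      (c₂ * t j + b₂) * (l₁ * t j + l₀) + (u₃ * t j ^ 2 + v₃ * t j + w₃) ≠ 0 := fun j =>
    Finset.prod_ne_zero_iff.1 (h₄ ▸ pow_ne_zero 2 ha₄) j (Finset.mem_univ j)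
  have hy : ∀ j, c₂ * t j + b₂ ≠ 0 := fun j => left_ne_zero_of_mul (n₂ j)
  have hk : ∀ j, c₁ * t j + b₁ ≠ 0 := fun j => left_ne_zero_of_mul (n₁ j)
  have hl : ∀ j, l₁ * t j + l₀ ≠ 0 := fun j => right_ne_zero_of_mul (n₁ j)
  set s : ι → M := fun j => (c₁ * t j + b₁) / (c₂ * t j + b₂) with hs
  have hsy : ∀ j, s j * (c₂ * t j + b₂) = c₁ * t j + b₁ := fun j => div_mul_cancel₀ _ (hy j)
  have hsinj : Function.Injective s := by
    intro i j hij
    have h := (div_eq_div_iff (hy i) (hy j)).1 hij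
    have : d * (t i + t j) = 0 := by
      rw [hd]
      linear_combination h + (c₂ * b₁ * t i + c₁ * b₂ * t j) * (CharTwo.two_eq_zero (R := M))
    exact ht (CharTwo.add_eq_zero.1 ((mul_eq_zero.1 this).resolve_left hd0))
  set κ := ∏ j, (c₂ * t j + b₂) with hκ
  have hκ0 : κ ≠ 0 := Finset.prod_ne_zero_iff.2 fun j _ => hy j
  set U := u₃ * b₂ ^ 2 + v₃ * b₂ * c₂ + w₃ * c₂ ^ 2 with hU
  set V := v₃ * d with hV
  set W := u₃ * b₁ ^ 2 + v₃ * b₁ * c₁ + w₃ * c₁ ^ 2 with hW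
  set L₁ := d * (l₁ * b₂ + l₀ * c₂) with hL₁
  set L₀ := d * (l₁ * b₁ + l₀ * c₁) with hL₀
  have x₂ : ∀ j, L₁ * s j + L₀ = d ^ 2 * ((c₂ * t j + b₂) * (l₁ * t j + l₀)) /
      (c₂ * t j + b₂) ^ 2 := fun j => by
    have := mobius_linear c₁ b₁ c₂ b₂ l₁ l₀ (t j)
    rw [← hd, ← hsy] at this
    rw [eq_div_iff (pow_ne_zero 2 (hy j))]
    linear_combination d * (c₂ * t j + b₂) * this
  have x₁ : ∀ j, s j * (L₁ * s j + L₀) = d ^ 2 * ((c₁ * t j + b₁) * (l₁ * t j + l₀)) /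
      (c₂ * t j + b₂) ^ 2 := fun j => by
    rw [x₂, ← hsy]; ring
  have x₃ : ∀ j, U * s j ^ 2 + V * s j + W = d ^ 2 * (u₃ * t j ^ 2 + v₃ * t j + w₃) /
      (c₂ * t j + b₂) ^ 2 := fun j => by
    have := mobius_quadratic u₃ v₃ w₃ c₁ b₁ c₂ b₂ (t j)
    rw [← hd, ← hsy] at this
    rw [eq_div_iff (pow_ne_zero 2 (hy j)), ← this]
    ring
  have x₄ : ∀ j, (U + L₁) * s j ^ 2 + (V + L₀ + L₁) * s j + (W + L₀) =
      d ^ 2 * ((c₁ * t j + b₁) * (l₁ * t j + l₀) + (c₂ * t j + b₂) * (l₁ * t j + l₀) +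
        (u₃ * t j ^ 2 + v₃ * t j + w₃)) / (c₂ * t j + b₂) ^ 2 := fun j => by
    rw [mul_add, mul_add, add_div, add_div, ← x₁, ← x₂, ← x₃]
    ring
  -- The scaling factors multiply over the five points to `(d ^ 5 / κ) ^ 2`, so the norms remain
  -- squares.
  have hprod : ∀ (x : ι → M) (a : M), ∏ j, x j = a ^ 2 →
      ∏ j, (d ^ 2 * x j / (c₂ * t j + b₂) ^ 2) = (d ^ 5 * a / κ) ^ 2 := by
    intro x a h
    rw [Finset.prod_div_distrib, Finset.prod_mul_distrib, h, Finset.prod_const, Finset.card_univ,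
      hι, Finset.prod_pow]
    ring
  have hfin := det_eq_zero_of_common_factor hι s hsinj L₁ L₀ U V W
    (d ^ 5 * a₁ / κ) (d ^ 5 * a₂ / κ) (d ^ 5 * a₃ / κ) (d ^ 5 * a₄ / κ)
    (by simp [hd0, hκ0, ha₁]) (by simp [hd0, hκ0, ha₂]) (by simp [hd0, hκ0, ha₃])
    (by simp [hd0, hκ0, ha₄])
    (by simp only [x₁]; exact hprod _ _ h₁) (by simp only [x₂]; exact hprod _ _ h₂)
    (by simp only [x₃]; exact hprod _ _ h₃) (by simp only [x₄]; exact hprod _ _ h₄)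
    (fun j => by
      have h := hE j
      have hsj : (c₁ * t j + b₁) * (l₁ * t j + l₀) =
          s j * ((c₂ * t j + b₂) * (l₁ * t j + l₀)) := by rw [← hsy]; ring
      have hs0 : s j ≠ 0 := div_ne_zero (hk j) (hy j)
      have m₂ := n₂ j
      have m₃ := n₃ j
      have m₄ := n₄ j
      have my := hy j
      rw [x₂, x₃, x₄]
      rw [hsj] at h m₄ ⊢
      generalize (c₂ * t j + b₂) * (l₁ * t j + l₀) = y₂ at *
      generalize u₃ * t j ^ 2 + v₃ * t j + w₃ = y₃ at *
      generalize s j * y₂ + y₂ + y₃ = y₄ at *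
      generalize c₂ * t j + b₂ = y at *
      rw [← mul_zero (d ^ 9 / κ / y ^ 4 * (s j * y₂ * y₃ * y₄)), ← h]
      field_simp
      ring)
  have := mobius_resultant u₃ v₃ w₃ c₁ b₁ c₂ b₂ l₁ l₀
  rw [← hd] at this
  have h' : d ^ 4 * (u₃ * l₀ ^ 2 + v₃ * l₀ * l₁ + w₃ * l₁ ^ 2) = 0 := by
    linear_combination hfin - d ^ 2 * this
  rw [(mul_eq_zero.1 h').resolve_left (pow_ne_zero 4 hd0), mul_zero]

theorem quadDet_eq_zero [IsAlgClosed M] {ι : Type*} [Fintype ι]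
    (hι : Fintype.card ι = 5) (t : ι → M) (ht : Function.Injective t)
    (u v w a : Fin 4 → M) (hu : ∑ i, u i = 0) (hv : ∑ i, v i = 0) (hw : ∑ i, w i = 0)
    (ha : ∀ i, a i ≠ 0) (hN : ∀ i, ∏ j, (u i * t j ^ 2 + v i * t j + w i) = a i ^ 2)
    (hE : ∀ j, ∑ i, a i / (u i * t j ^ 2 + v i * t j + w i) = 0) :
    quadDet u v w = 0 := by
  have hu' := hu
  have hv' := hv
  have hw' := hw
  simp only [Fin.sum_univ_four] at hu' hv' hw' hE
  by_cases hρ : ∀ i j, i ≠ j → quadRes (u i) (v i) (w i) (u j) (v j) (w j) ≠ 0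
  · set Q : Fin 4 → M[X] := fun i => C (u i) * X ^ 2 + C (v i) * X + C (w i) with hQ
    have hQe : ∀ i r, (Q i).eval r = u i * r ^ 2 + v i * r + w i := by intro i r; simp [hQ]
    set p : M[X] := C (a 0) * (Q 1 * Q 2 * Q 3) + C (a 1) * (Q 0 * Q 2 * Q 3)
      + C (a 2) * (Q 0 * Q 1 * Q 3) + C (a 3) * (Q 0 * Q 1 * Q 2) with hp
    have hd : ∀ i j k, (Q i * Q j * Q k).natDegree ≤ 6 := fun i j k =>
      (natDegree_quadratic_mul_le _ _ _ _ _ _ _ _ _).1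
    have hc : ∀ i j k, (Q i * Q j * Q k).coeff 6 = u i * u j * u k := fun i j k =>
      (natDegree_quadratic_mul_le _ _ _ _ _ _ _ _ _).2
    have hpd : p.natDegree ≤ 6 := by
      rw [hp]
      refine natDegree_add_le_of_degree_le (natDegree_add_le_of_degree_le
        (natDegree_add_le_of_degree_le ?_ ?_) ?_) ?_ <;>
      exact (natDegree_C_mul_le _ _).trans (hd _ _ _)
    have hn : ∀ i j, u i * t j ^ 2 + v i * t j + w i ≠ 0 := fun i j =>
      Finset.prod_ne_zero_iff.1 (hN i ▸ pow_ne_zero 2 (ha i)) j (Finset.mem_univ j)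
    have hpe : ∀ r, p.eval r =
        a 0 * ((Q 1).eval r * (Q 2).eval r * (Q 3).eval r)
        + a 1 * ((Q 0).eval r * (Q 2).eval r * (Q 3).eval r)
        + a 2 * ((Q 0).eval r * (Q 1).eval r * (Q 3).eval r)
        + a 3 * ((Q 0).eval r * (Q 1).eval r * (Q 2).eval r) := by
      intro r
      simp only [hp, eval_add, eval_mul, eval_C]
    obtain ⟨e, f, hef, hc6⟩ := exists_linear_cofactor hι ht (p := p) (fun j => by
      rw [hpe]
      simp only [hQe]
      have h := hE j
      have m₀ := hn 0 j
      have m₁ := hn 1 j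
      have m₂ := hn 2 j
      have m₃ := hn 3 j
      generalize u 0 * t j ^ 2 + v 0 * t j + w 0 = y₀ at *
      generalize u 1 * t j ^ 2 + v 1 * t j + w 1 = y₁ at *
      generalize u 2 * t j ^ 2 + v 2 * t j + w 2 = y₂ at *
      generalize u 3 * t j ^ 2 + v 3 * t j + w 3 = y₃ at *
      rw [← mul_zero (y₀ * y₁ * y₂ * y₃), ← h]
      field_simp) hpd
    simp only [hpe, hQe] at hef
    have hc6' : a 0 * (u 1 * u 2 * u 3) + a 1 * (u 0 * u 2 * u 3)
        + a 2 * (u 0 * u 1 * u 3) + a 3 * (u 0 * u 1 * u 2) = e := by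
      rw [← hc6, hp]
      simp only [coeff_add, coeff_C_mul, hc]
    refine quadDet_eq_zero_of_residual u v w e f hu hv hw
      (fun i j => quadRes (u i) (v i) (w i) (u j) (v j) (w j)) (fun _ _ => rfl) hρ ?_ ?_ ?_ ?_
    · exact eval_residual_eq_quadRes_mul hι t _ _ _ _ _ _ _ _ _ _ _ _ _ e f (ha 0) (hN 0)
        (fun r hr => by rw [← hef, hr]; ring) (fun h => by rw [← hc6', h]; ring)
    · rw [eval_residual_eq_quadRes_mul hι t _ _ _ (u 0) (v 0) (w 0) (u 2) (v 2) (w 2) (u 3) (v 3)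
        (w 3) _ e f (ha 1) (hN 1)
        (fun r hr => by rw [← hef, hr]; ring) (fun h => by rw [← hc6', h]; ring)]
      unfold quadRes
      ring
    · rw [eval_residual_eq_quadRes_mul hι t _ _ _ (u 0) (v 0) (w 0) (u 1) (v 1) (w 1) (u 3) (v 3)
        (w 3) _ e f (ha 2) (hN 2)
        (fun r hr => by rw [← hef, hr]; ring) (fun h => by rw [← hc6', h]; ring)]
      unfold quadRes
      ring
    · rw [eval_residual_eq_quadRes_mul hι t _ _ _ (u 0) (v 0) (w 0) (u 1) (v 1) (w 1) (u 2) (v 2)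
        (w 2) _ e f (ha 3) (hN 3)
        (fun r hr => by rw [← hef, hr]; ring) (fun h => by rw [← hc6', h]; ring)]
      unfold quadRes
      ring
  · push Not at hρ
    -- As the four quadratics sum to zero, any three of them have the same determinant, so whichever
    -- pair shares a root will do.
    have hu3 : u 3 = u 0 + u 1 + u 2 := by grind
    have hv3 : v 3 = v 0 + v 1 + v 2 := by grind
    have hw3 : w 3 = w 0 + w 1 + w 2 := by grind
    have key : ∀ i j k l : Fin 4, u i + u j + u k + u l = 0 → v i + v j + v k + v l = 0 →
        w i + w j + w k + w l = 0 →
        (∀ x : Fin 4 → M, x i + x j + x k + x l = x 0 + x 1 + x 2 + x 3) →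
        quadRes (u i) (v i) (w i) (u j) (v j) (w j) = 0 →
        u i * (v j * w k + v k * w j) + v i * (u j * w k + u k * w j) +
          w i * (u j * v k + u k * v j) = 0 := by
      intro i j k l h₁ h₂ h₃ h₄ h₅
      exact det_eq_zero_of_quadRes_eq_zero hι t ht _ _ _ _ _ _ _ _ _ (u l) (v l) (w l)
        (a i) (a j) (a k) (a l) h₁ h₂ h₃ (ha i) (ha j) (ha k) (ha l) (hN i) (hN j) (hN k) (hN l)
        (fun s => by
          rw [← hE s]
          exact h₄ fun i => a i / (u i * t s ^ 2 + v i * t s + w i)) h₅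
    obtain ⟨i, j, hij, h0⟩ := hρ
    wlog hlt : i < j generalizing i j
    · exact this j i hij.symm (by rw [← h0]; unfold quadRes; ring)
        (lt_of_le_of_ne (not_lt.1 hlt) hij.symm)
    have key2 : ∀ k l : Fin 4,
        (∀ x : Fin 4 → M, x i + x j + x k + x l = x 0 + x 1 + x 2 + x 3) →
        u i * (v j * w k + v k * w j) + v i * (u j * w k + u k * w j) +
          w i * (u j * v k + u k * v j) = 0 := fun k l h =>
      key i j k l (by rw [h, hu']) (by rw [h, hv']) (by rw [h, hw']) h h0
    have hcases : (i = 0 ∧ j = 1) ∨ (i = 0 ∧ j = 2) ∨ (i = 1 ∧ j = 2) ∨ (i = 0 ∧ j = 3) ∨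
        (i = 1 ∧ j = 3) ∨ (i = 2 ∧ j = 3) := by
      clear key2 h0 hij
      revert i j
      decide
    rcases hcases with ⟨rfl, rfl⟩ | ⟨rfl, rfl⟩ | ⟨rfl, rfl⟩ | ⟨rfl, rfl⟩ | ⟨rfl, rfl⟩ | ⟨rfl, rfl⟩
    · exact key2 2 3 fun x => by ring
    · have := key2 1 3 fun x => by ring
      rw [← this, quadDet]
      clear * -
      grind
    · have := key2 0 3 fun x => by ring
      rw [← this, quadDet]
      clear * -
      grind
    · have := key2 1 2 fun x => by ring
      rw [hu3, hv3, hw3] at this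
      rw [← this, quadDet]
      clear * -
      grind
    · have := key2 0 2 fun x => by ring
      rw [hu3, hv3, hw3] at this
      rw [← this, quadDet]
      clear * -
      grind
    · have := key2 0 1 fun x => by ring
      rw [hu3, hv3, hw3] at this
      rw [← this, quadDet]
      clear * -
      grind

end Config

/-! ### Degree-five extensions: conics and quadratic parametrization -/

section Quintic

variable {K L : Type*} [Field K] [Field L] [Algebra K L]

local notation "φ" => algebraMap K L

/-- The degree 5 is prime, so there are no proper intermediate fields. -/
theorem adjoin_eq_top_of_finrank_five (h5 : Module.finrank K L = 5) {θ : L}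
    (hθ : θ ∉ Set.range φ) : IntermediateField.adjoin K {θ} = ⊤ := by
  have : IsSimpleOrder (IntermediateField K L) :=
    IntermediateField.isSimpleOrder_of_finrank_prime K L (by rw [h5]; norm_num)
  refine (eq_bot_or_eq_top _).resolve_left fun h => hθ ?_
  rw [← IntermediateField.mem_bot, ← h]
  exact IntermediateField.mem_adjoin_simple_self K θ

theorem eq_zero_of_aeval_eq_zero (h5 : Module.finrank K L = 5) {θ : L} (hθ : θ ∉ Set.range φ)
    {p : K[X]} (hp : p.natDegree ≤ 4) (h : aeval θ p = 0) : p = 0 := by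
  have : FiniteDimensional K L := Module.finite_of_finrank_pos (by omega)
  by_contra hne
  have hd := minpoly.degree_le_of_ne_zero K θ hne h
  have hd' := natDegree_le_natDegree hd
  have hθ_int : IsIntegral K θ := IsIntegral.of_finite K θ
  rw [← IntermediateField.adjoin.finrank hθ_int, adjoin_eq_top_of_finrank_five h5 hθ,
    IntermediateField.finrank_top', h5] at hd'
  omega

theorem coeff_eq_zero_of_cubic_relation (h5 : Module.finrank K L = 5) {θ : L}
    (hθ : θ ∉ Set.range φ) (c₃ c₂ c₁ c₀ : K)
    (h : φ c₃ * θ ^ 3 + φ c₂ * θ ^ 2 + φ c₁ * θ + φ c₀ = 0) :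
    c₃ = 0 ∧ c₂ = 0 ∧ c₁ = 0 ∧ c₀ = 0 := by
  have hp := eq_zero_of_aeval_eq_zero h5 hθ
    (p := C c₃ * X ^ 3 + C c₂ * X ^ 2 + C c₁ * X + C c₀)
    (natDegree_cubic_le.trans (by norm_num)) (by simpa using h)
  have hc : ∀ n, (C c₃ * X ^ 3 + C c₂ * X ^ 2 + C c₁ * X + C c₀).coeff n = 0 := by simp [hp]
  refine ⟨by simpa [coeff_X, coeff_C] using hc 3, by simpa [coeff_X, coeff_C] using hc 2,
    by simpa [coeff_X, coeff_C] using hc 1, by simpa [coeff_X, coeff_C] using hc 0⟩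

theorem exists_sq_eq [Finite K] [CharP K 2] (a : K) : ∃ b : K, b ^ 2 = a := by
  obtain ⟨b, hb⟩ := FiniteField.isSquare_of_char_two (ringChar.eq K 2 ▸ rfl) a
  exact ⟨b, by rw [hb, sq]⟩

/-- A conic with a non-vanishing mixed coefficient through `(x₁ : x₂ : x₃)` parametrizes the
span of `x₁, x₂, x₃` by quadratic polynomials. -/
theorem exists_quadratic_param_of_conic [Finite K] [CharP K 2] (h5 : Module.finrank K L = 5)
    (x₁ x₂ x₃ : L)
    (hlin : ∀ c₁ c₂ c₃ : K, φ c₁ * x₁ + φ c₂ * x₂ + φ c₃ * x₃ = 0 → c₁ = 0 ∧ c₂ = 0 ∧ c₃ = 0)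
    (a b c A B C : K) (hC : C ≠ 0)
    (h : φ a * x₁ ^ 2 + φ b * x₂ ^ 2 + φ c * x₃ ^ 2 + φ A * (x₂ * x₃) + φ B * (x₁ * x₃)
      + φ C * (x₁ * x₂) = 0) :
    ∃ (μ θ : L) (u₁ v₁ w₁ u₂ v₂ w₂ u₃ v₃ w₃ : K), μ ≠ 0 ∧ θ ∉ Set.range φ ∧
      x₁ = μ * (φ u₁ * θ ^ 2 + φ v₁ * θ + φ w₁) ∧ x₂ = μ * (φ u₂ * θ ^ 2 + φ v₂ * θ + φ w₂) ∧
      x₃ = μ * (φ u₃ * θ ^ 2 + φ v₃ * θ + φ w₃) := by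
  have : CharP L 2 := charP_of_injective_algebraMap (algebraMap K L).injective 2
  obtain ⟨α, hα⟩ := exists_sq_eq (a / C)
  obtain ⟨β, hβ⟩ := exists_sq_eq (b / C)
  obtain ⟨γ, hγ⟩ := exists_sq_eq (c / C + (A / C) * (B / C))
  -- The product `y₁ * y₂` absorbs all mixed terms of the conic; what remains is diagonal, hence the
  -- square of a linear form `y₃` because `K` is perfect. The conic becomes `y₃² = y₁ y₂`,
  -- parametrized by `θ = y₃ / y₂`.
  set y₁ := x₁ + φ (A / C) * x₃ with hy₁
  set y₂ := x₂ + φ (B / C) * x₃ with hy₂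
  set y₃ := φ α * x₁ + φ β * x₂ + φ γ * x₃ with hy₃
  have hφC : φ C ≠ 0 := by simpa using hC
  have hconic : y₃ ^ 2 = y₁ * y₂ := by
    have h' : φ (a / C) * x₁ ^ 2 + φ (b / C) * x₂ ^ 2 + φ (c / C) * x₃ ^ 2
        + φ (A / C) * (x₂ * x₃) + φ (B / C) * (x₁ * x₃) + x₁ * x₂ = 0 := by
      simp only [map_div₀]
      rw [← zero_div (φ C), ← h]
      field_simp
    have e : y₃ ^ 2 = φ (α ^ 2) * x₁ ^ 2 + φ (β ^ 2) * x₂ ^ 2 + φ (γ ^ 2) * x₃ ^ 2 := by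
      rw [hy₃, CharTwo.add_sq, CharTwo.add_sq]
      simp only [map_pow]
      ring
    rw [e, hα, hβ, hγ, map_add, map_mul]
    apply CharTwo.add_eq_zero.1
    rw [hy₁, hy₂]
    linear_combination h' + φ (A / C) * φ (B / C) * x₃ ^ 2 * CharTwo.two_eq_zero (R := L)
  have hy₂0 : y₂ ≠ 0 := by
    intro h0
    have := hlin 0 1 (B / C) (by rw [← h0, hy₂]; simp)
    simp at this
  set θ := y₃ / y₂ with hθdef
  have hθ₃ : y₃ = y₂ * θ := by rw [hθdef]; field_simp
  have hθ₁ : y₁ = y₂ * θ ^ 2 := by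
    rw [hθdef, div_pow, hconic]; field_simp
  have hθ : θ ∉ Set.range φ := by
    rintro ⟨k, hk⟩
    have := hlin 1 (-k ^ 2) (A / C - k ^ 2 * (B / C)) (by
      rw [← hk, hy₁, hy₂] at hθ₁
      simp only [map_one, map_neg, map_pow, map_sub, map_mul]
      linear_combination hθ₁)
    simp at this
  set e := α * (A / C) + β * (B / C) + γ with he
  have hrel : φ e * x₃ = y₂ * (φ α * θ ^ 2 + θ + φ β) := by
    have h1 : φ e * x₃ = y₃ + (φ α * y₁ + φ β * y₂) := by
      rw [hy₃, hy₁, hy₂, he]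
      simp only [map_add, map_mul]
      linear_combination (-(φ α * x₁ + φ β * x₂)) * CharTwo.two_eq_zero (R := L)
    rw [h1, hθ₃, hθ₁]
    ring
  have he0 : e ≠ 0 := by
    intro h0
    rw [h0, map_zero, zero_mul] at hrel
    have := (mul_eq_zero.1 hrel.symm).resolve_left hy₂0
    have := coeff_eq_zero_of_cubic_relation h5 hθ 0 α 1 β (by simpa using this)
    simp at this
  have hφe : φ e ≠ 0 := by simpa using he0
  have hx₃ : x₃ = y₂ * (φ (α / e) * θ ^ 2 + φ (1 / e) * θ + φ (β / e)) := by
    simp only [map_div₀, map_one]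
    field_simp
    linear_combination hrel
  refine ⟨y₂, θ, 1 - A / C * (α / e), -(A / C * (1 / e)), -(A / C * (β / e)),
    -(B / C * (α / e)), -(B / C * (1 / e)), 1 - B / C * (β / e), α / e, 1 / e, β / e, hy₂0, hθ,
    ?_, ?_, hx₃⟩
  · have : x₁ = y₁ - φ (A / C) * x₃ := by rw [hy₁]; ring
    rw [this, hθ₁, hx₃]
    simp only [map_sub, map_neg, map_mul, map_one]
    ring
  · have : x₂ = y₂ - φ (B / C) * x₃ := by rw [hy₂]; ring
    rw [this, hx₃]
    simp only [map_sub, map_neg, map_mul, map_one]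
    ring

/-- Three linearly independent elements of a quintic extension lie in `μ ⟨1, θ, θ²⟩`. -/
theorem exists_quadratic_param [Finite K] [CharP K 2] (h5 : Module.finrank K L = 5)
    (x₁ x₂ x₃ : L)
    (hlin : ∀ c₁ c₂ c₃ : K, φ c₁ * x₁ + φ c₂ * x₂ + φ c₃ * x₃ = 0 → c₁ = 0 ∧ c₂ = 0 ∧ c₃ = 0) :
    ∃ (μ θ : L) (u₁ v₁ w₁ u₂ v₂ w₂ u₃ v₃ w₃ : K), μ ≠ 0 ∧ θ ∉ Set.range φ ∧
      x₁ = μ * (φ u₁ * θ ^ 2 + φ v₁ * θ + φ w₁) ∧ x₂ = μ * (φ u₂ * θ ^ 2 + φ v₂ * θ + φ w₂) ∧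
      x₃ = μ * (φ u₃ * θ ^ 2 + φ v₃ * θ + φ w₃) := by
  have : FiniteDimensional K L := Module.finite_of_finrank_pos (by omega)
  have : CharP L 2 := charP_of_injective_algebraMap (algebraMap K L).injective 2
  -- Six elements in dimension five. Some mixed coefficient of the relation is nonzero, since a
  -- diagonal relation would be the square of a linear one.
  have hdep : ¬ LinearIndependent K ![x₁ ^ 2, x₂ ^ 2, x₃ ^ 2, x₂ * x₃, x₁ * x₃, x₁ * x₂] := by
    intro h
    have := h.fintype_card_le_finrank
    rw [h5] at this
    simp at this
  obtain ⟨g, hg, hne⟩ := Fintype.not_linearIndependent_iff.1 hdep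
  simp only [Fin.sum_univ_six, Algebra.smul_def] at hg
  have hg' : φ (g 0) * x₁ ^ 2 + φ (g 1) * x₂ ^ 2 + φ (g 2) * x₃ ^ 2 + φ (g 3) * (x₂ * x₃)
    + φ (g 4) * (x₁ * x₃) + φ (g 5) * (x₁ * x₂) = 0 := hg
  by_cases hC : g 5 = 0
  · by_cases hB : g 4 = 0
    · by_cases hA : g 3 = 0
      · exfalso
        obtain ⟨α, hα⟩ := exists_sq_eq (g 0)
        obtain ⟨β, hβ⟩ := exists_sq_eq (g 1)
        obtain ⟨γ, hγ⟩ := exists_sq_eq (g 2)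
        rw [hA, hB, hC, ← hα, ← hβ, ← hγ] at hg'
        have : (φ α * x₁ + φ β * x₂ + φ γ * x₃) ^ 2 = 0 := by
          rw [CharTwo.add_sq, CharTwo.add_sq, ← hg']
          simp only [map_pow, map_zero]
          ring
        obtain ⟨h₁, h₂, h₃⟩ := hlin _ _ _ (pow_eq_zero_iff two_ne_zero |>.1 this)
        have z₀ : g 0 = 0 := by rw [← hα, h₁, zero_pow two_ne_zero]
        have z₁ : g 1 = 0 := by rw [← hβ, h₂, zero_pow two_ne_zero]
        have z₂ : g 2 = 0 := by rw [← hγ, h₃, zero_pow two_ne_zero]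
        obtain ⟨i, hi⟩ := hne
        refine hi ?_
        clear hg hi
        fin_cases i
        exacts [z₀, z₁, z₂, hA, hB, hC]
      · obtain ⟨μ, θ, u₁, v₁, w₁, u₂, v₂, w₂, u₃, v₃, w₃, hμ, hθ, e₁, e₂, e₃⟩ :=
          exists_quadratic_param_of_conic h5 x₂ x₃ x₁
            (fun c₁ c₂ c₃ h => by
              obtain ⟨k₁, k₂, k₃⟩ := hlin c₃ c₁ c₂ (by rw [← h]; ring)
              exact ⟨k₂, k₃, k₁⟩)
            (g 1) (g 2) (g 0) (g 4) (g 5) (g 3) hA (by rw [← hg']; ring)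
        exact ⟨μ, θ, _, _, _, _, _, _, _, _, _, hμ, hθ, e₃, e₁, e₂⟩
    · obtain ⟨μ, θ, u₁, v₁, w₁, u₂, v₂, w₂, u₃, v₃, w₃, hμ, hθ, e₁, e₂, e₃⟩ :=
        exists_quadratic_param_of_conic h5 x₁ x₃ x₂
          (fun c₁ c₂ c₃ h => by
            obtain ⟨k₁, k₂, k₃⟩ := hlin c₁ c₃ c₂ (by rw [← h]; ring)
            exact ⟨k₁, k₃, k₂⟩)
          (g 0) (g 2) (g 1) (g 3) (g 5) (g 4) hB (by rw [← hg']; ring)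
      exact ⟨μ, θ, _, _, _, _, _, _, _, _, _, hμ, hθ, e₁, e₃, e₂⟩
  · exact exists_quadratic_param_of_conic h5 x₁ x₂ x₃ hlin _ _ _ _ _ _ hC hg'

end Quintic

/-! ### Vanishing quadruples do not exist -/

/-- Four distinct nonzero elements `x i` with sum zero and `∑ a i / x i = 0`, where
`a i ^ 2` is the norm of `x i`. -/
structure IsVanishingQuadruple {K L : Type*} [Field K] [Field L] [Algebra K L]
    (a : Fin 4 → K) (x : Fin 4 → L) : Prop where
  inj : Function.Injective x
  ne_zero : ∀ i, x i ≠ 0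
  sum_eq : ∑ i, x i = 0
  sq_eq_norm : ∀ i, a i ^ 2 = Algebra.norm K (x i)
  sum_div_eq : ∑ i, algebraMap K L (a i) / x i = 0

section Quadruple

variable {K L : Type*} [Field K] [Field L] [Algebra K L]

local notation "φ" => algebraMap K L

theorem IsVanishingQuadruple.comp {a : Fin 4 → K} {x : Fin 4 → L} (h : IsVanishingQuadruple a x)
    (σ : Equiv.Perm (Fin 4)) : IsVanishingQuadruple (a ∘ σ) (x ∘ σ) where
  inj := h.inj.comp σ.injective
  ne_zero i := h.ne_zero _
  sum_eq := by simpa using (Equiv.sum_comp σ x).trans h.sum_eq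
  sq_eq_norm i := h.sq_eq_norm _
  sum_div_eq := (Equiv.sum_comp σ fun i => φ (a i) / x i).trans h.sum_div_eq

theorem norm_algebraMap_mul (h5 : Module.finrank K L = 5) (c : K) (x : L) :
    Algebra.norm K (φ c * x) = c ^ 5 * Algebra.norm K x := by
  rw [map_mul, Algebra.norm_algebraMap, h5]

theorem IsVanishingQuadruple.ne_zero' {a : Fin 4 → K} {x : Fin 4 → L}
    (h5 : Module.finrank K L = 5) (h : IsVanishingQuadruple a x) (i : Fin 4) : a i ≠ 0 := by
  have : FiniteDimensional K L := Module.finite_of_finrank_pos (by omega)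
  intro h0
  have := h.sq_eq_norm i
  rw [h0, zero_pow two_ne_zero, eq_comm, Algebra.norm_eq_zero_iff] at this
  exact h.ne_zero i this

variable [Finite K] [CharP K 2]

/-- Put `θ = x 2 / x 1`. If `θ = d` lies in `K`, squaring the relation gives `c³ + 1 + d³ + (c + 1 +
d)³ = 0`, whose left side factors as `(c + 1)(c + d)(1 + d)`, against distinctness. Otherwise
clearing denominators gives a quadratic relation for `θ`, whose constant term forces `c = 1`. -/
theorem IsVanishingQuadruple.zero_ne_smul_one {a : Fin 4 → K} {x : Fin 4 → L}
    (h5 : Module.finrank K L = 5) (h : IsVanishingQuadruple a x) (c : K) :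
    x 0 ≠ φ c * x 1 := by
  intro hx
  have : FiniteDimensional K L := Module.finite_of_finrank_pos (by omega)
  have hL : CharP L 2 := charP_of_injective_algebraMap (algebraMap K L).injective 2
  have ha := h.ne_zero' h5
  have hne := h.ne_zero
  have hsum := h.sum_eq
  have hrel := h.sum_div_eq
  rw [Fin.sum_univ_four] at hsum hrel
  have hx1 := hne 1
  obtain ⟨θ, hθ⟩ : ∃ θ, x 2 = θ * x 1 := ⟨x 2 / x 1, (div_mul_cancel₀ _ hx1).symm⟩
  have hx3 : x 3 = (φ c + 1 + θ) * x 1 := by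
    apply CharTwo.add_eq_zero.1
    rw [← hsum, hx, hθ]
    ring
  have hc : c ≠ 0 := by
    rintro rfl
    exact hne 0 (by rw [hx, map_zero, zero_mul])
  have hφc : φ c ≠ 0 := by simpa using hc
  have hθ0 : θ ≠ 0 := by
    rintro rfl
    exact hne 2 (by rw [hθ, zero_mul])
  have hθ3 : φ c + 1 + θ ≠ 0 := by
    intro h0
    exact hne 3 (by rw [hx3, h0, zero_mul])
  have hrel' : φ (a 0) / φ c + φ (a 1) + φ (a 2) / θ + φ (a 3) / (φ c + 1 + θ) = 0 := by
    rw [hx, hθ, hx3] at hrel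
    rw [← mul_zero (x 1), ← hrel]
    field_simp
  by_cases hK : θ ∈ Set.range φ
  · obtain ⟨d, rfl⟩ := hK
    have hd : d ≠ 0 := by simpa using hθ0
    have hcd : c + 1 + d ≠ 0 := by
      intro h0
      apply hθ3
      rw [← map_one φ, ← map_add, ← map_add, h0, map_zero]
    have hr : a 0 / c + a 1 + a 2 / d + a 3 / (c + 1 + d) = 0 := by
      apply (algebraMap K L).injective
      simpa using hrel'
    obtain ⟨N, hN⟩ : ∃ N, N = Algebra.norm K (x 1) := ⟨_, rfl⟩
    have hN0 : N ≠ 0 := by rw [hN, Ne, Algebra.norm_eq_zero_iff]; exact hx1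
    have n0 := h.sq_eq_norm 0
    have n1 := h.sq_eq_norm 1
    have n2 := h.sq_eq_norm 2
    have n3 := h.sq_eq_norm 3
    rw [hx, norm_algebraMap_mul h5, ← hN] at n0
    rw [← hN] at n1
    rw [hθ, norm_algebraMap_mul h5, ← hN] at n2
    rw [hx3, ← map_one φ, ← map_add, ← map_add, norm_algebraMap_mul h5, ← hN] at n3
    have hsq : (a 0 / c + a 1 + a 2 / d + a 3 / (c + 1 + d)) ^ 2 = 0 := by rw [hr]; simp
    rw [CharTwo.add_sq, CharTwo.add_sq, CharTwo.add_sq, div_pow, div_pow, div_pow, n0, n1, n2, n3]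
      at hsq
    have hcube : N * (c ^ 3 + 1 + d ^ 3 + (c + 1 + d) ^ 3) = 0 := by
      rw [← hsq]
      field_simp
    have hcube' := (mul_eq_zero.1 hcube).resolve_left hN0
    have hfac : (c + 1) * (c + d) * (1 + d) = 0 := by
      clear * - hcube'
      grind
    rcases mul_eq_zero.1 hfac with hfac | h0
    · rcases mul_eq_zero.1 hfac with h0 | h0
      · have : c = 1 := CharTwo.add_eq_zero.1 h0
        exact absurd (h.inj (show x 0 = x 1 by rw [hx, this, map_one, one_mul])) (by decide)
      · have : c = d := CharTwo.add_eq_zero.1 h0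
        exact absurd (h.inj (show x 0 = x 2 by rw [hx, this, hθ])) (by decide)
    · have : 1 = d := CharTwo.add_eq_zero.1 h0
      exact absurd (h.inj (show x 1 = x 2 by rw [hθ, ← this, map_one, one_mul])) (by decide)
  · have hpoly := coeff_eq_zero_of_cubic_relation h5 hK 0 (a 0 / c + a 1)
      ((a 0 / c + a 1) * (c + 1) + a 2 + a 3) (a 2 * (c + 1)) (by
        simp only [map_zero, map_add, map_mul, map_div₀, map_one, zero_mul, zero_add]
        rw [← mul_zero (θ * (φ c + 1 + θ)), ← hrel']
        field_simp
        ring)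
    have : c + 1 = 0 := by simpa [ha 2] using hpoly.2.2.2
    have : c = 1 := CharTwo.add_eq_zero.1 this
    exact absurd (h.inj (show x 0 = x 1 by rw [hx, this, map_one, one_mul])) (by decide)

theorem IsVanishingQuadruple.ne_smul {a : Fin 4 → K} {x : Fin 4 → L}
    (h5 : Module.finrank K L = 5) (h : IsVanishingQuadruple a x) {i j : Fin 4} (hij : i ≠ j)
    (c : K) : x i ≠ φ c * x j := by
  obtain ⟨σ, h0, h1⟩ : ∃ σ : Equiv.Perm (Fin 4), σ 0 = i ∧ σ 1 = j := by
    revert i j; decide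
  have := (h.comp σ).zero_ne_smul_one h5 c
  simpa [h0, h1] using this

/-- Clearing denominators gives a cubic relation for `x 0 / x 1`, so its constant term `a 0 * d * (d
+ 1)` vanishes. Then `x 2` (if `d = 0`) or `x 3` (if `d = 1`) is a multiple of `x 0`, which
`ne_smul` excludes. -/
theorem IsVanishingQuadruple.two_ne_combination {a : Fin 4 → K} {x : Fin 4 → L}
    (h5 : Module.finrank K L = 5) (h : IsVanishingQuadruple a x) (c d : K) :
    x 2 ≠ φ c * x 0 + φ d * x 1 := by
  intro hx2
  have hL : CharP L 2 := charP_of_injective_algebraMap (algebraMap K L).injective 2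
  have ha := h.ne_zero' h5
  have hne := h.ne_zero
  have hsum := h.sum_eq
  have hrel := h.sum_div_eq
  rw [Fin.sum_univ_four] at hsum hrel
  have hx1 := hne 1
  obtain ⟨θ, hθ⟩ : ∃ θ, x 0 = θ * x 1 := ⟨x 0 / x 1, (div_mul_cancel₀ _ hx1).symm⟩
  have hK : θ ∉ Set.range φ := by
    rintro ⟨e, rfl⟩
    exact h.ne_smul h5 (show (0 : Fin 4) ≠ 1 by decide) e hθ
  have hx2' : x 2 = (φ c * θ + φ d) * x 1 := by rw [hx2, hθ]; ring
  have hx3 : x 3 = (φ (c + 1) * θ + φ (d + 1)) * x 1 := by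
    apply CharTwo.add_eq_zero.1
    rw [← hsum, hx2', hθ, map_add, map_add, map_one]
    ring
  have n0 : θ ≠ 0 := by rintro rfl; exact hne 0 (by rw [hθ, zero_mul])
  have n2 : φ c * θ + φ d ≠ 0 := by intro h0; exact hne 2 (by rw [hx2', h0, zero_mul])
  have n3 : φ (c + 1) * θ + φ (d + 1) ≠ 0 := by
    intro h0; exact hne 3 (by rw [hx3, h0, zero_mul])
  have hrel' : φ (a 0) / θ + φ (a 1) + φ (a 2) / (φ c * θ + φ d)
      + φ (a 3) / (φ (c + 1) * θ + φ (d + 1)) = 0 := by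
    rw [hθ, hx2', hx3] at hrel
    rw [← mul_zero (x 1), ← hrel]
    field_simp
  have hpoly := coeff_eq_zero_of_cubic_relation h5 hK
    (a 1 * (c * (c + 1)))
    (a 0 * (c * (c + 1)) + a 1 * (c * (d + 1) + d * (c + 1)) + a 2 * (c + 1) + a 3 * c)
    (a 0 * (c * (d + 1) + d * (c + 1)) + a 1 * (d * (d + 1)) + a 2 * (d + 1) + a 3 * d)
    (a 0 * (d * (d + 1))) (by
      rw [← mul_zero (θ * (φ c * θ + φ d) * (φ (c + 1) * θ + φ (d + 1))), ← hrel']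
      generalize c + 1 = c' at *
      generalize d + 1 = d' at *
      simp only [map_add, map_mul]
      field_simp
      ring)
  have hd : d * (d + 1) = 0 := by simpa [ha 0] using hpoly.2.2.2
  rcases mul_eq_zero.1 hd with h0 | h0
  · refine h.ne_smul h5 (show (2 : Fin 4) ≠ 0 by decide) c ?_
    rw [hx2, h0, map_zero, zero_mul, add_zero]
  · refine h.ne_smul h5 (show (3 : Fin 4) ≠ 0 by decide) (c + 1) ?_
    rw [hx3, hθ, h0, map_zero, add_zero, mul_assoc]

theorem IsVanishingQuadruple.linearIndependent {a : Fin 4 → K} {x : Fin 4 → L}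
    (h5 : Module.finrank K L = 5) (h : IsVanishingQuadruple a x) (c₀ c₁ c₂ : K)
    (hc : φ c₀ * x 0 + φ c₁ * x 1 + φ c₂ * x 2 = 0) : c₀ = 0 ∧ c₁ = 0 ∧ c₂ = 0 := by
  have key : ∀ (i j k : Fin 4) (σ : Equiv.Perm (Fin 4)), σ 0 = i → σ 1 = j → σ 2 = k →
      ∀ d₀ d₁ d₂ : K, φ d₀ * x i + φ d₁ * x j + φ d₂ * x k = 0 → d₂ = 0 := by
    intro i j k σ hi hj hk d₀ d₁ d₂ hd
    by_contra h2
    have hφ : φ d₂ ≠ 0 := by simpa using h2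
    refine (h.comp σ).two_ne_combination h5 (-d₀ / d₂) (-d₁ / d₂) ?_
    simp only [Function.comp, hi, hj, hk, map_div₀, map_neg]
    field_simp
    linear_combination hd
  refine ⟨?_, ?_, ?_⟩
  · obtain ⟨σ, h0, h1, h2⟩ : ∃ σ : Equiv.Perm (Fin 4), σ 0 = 1 ∧ σ 1 = 2 ∧ σ 2 = 0 := by decide
    exact key 1 2 0 σ h0 h1 h2 c₁ c₂ c₀ (by rw [← hc]; ring)
  · obtain ⟨σ, h0, h1, h2⟩ : ∃ σ : Equiv.Perm (Fin 4), σ 0 = 0 ∧ σ 1 = 2 ∧ σ 2 = 1 := by decide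
    exact key 0 2 1 σ h0 h1 h2 c₀ c₂ c₁ (by rw [← hc]; ring)
  · exact key 0 1 2 1 rfl rfl rfl c₀ c₁ c₂ hc

theorem not_isVanishingQuadruple (h5 : Module.finrank K L = 5) (a : Fin 4 → K) (x : Fin 4 → L) :
    ¬ IsVanishingQuadruple a x := by
  intro h
  have : FiniteDimensional K L := Module.finite_of_finrank_pos (by omega)
  have hL : CharP L 2 := charP_of_injective_algebraMap (algebraMap K L).injective 2
  have hlin := h.linearIndependent h5
  obtain ⟨μ, θ, u₁, v₁, w₁, u₂, v₂, w₂, u₃, v₃, w₃, hμ, hθ, e₁, e₂, e₃⟩ :=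
    exists_quadratic_param h5 (x 0) (x 1) (x 2) hlin
  set u : Fin 4 → K := ![u₁, u₂, u₃, u₁ + u₂ + u₃] with hu
  set v : Fin 4 → K := ![v₁, v₂, v₃, v₁ + v₂ + v₃] with hv
  set w : Fin 4 → K := ![w₁, w₂, w₃, w₁ + w₂ + w₃] with hw
  have hx : ∀ i, x i = μ * (φ (u i) * θ ^ 2 + φ (v i) * θ + φ (w i)) := by
    have hsum := h.sum_eq
    rw [Fin.sum_univ_four] at hsum
    have e₄ : x 3 = μ * (φ (u₁ + u₂ + u₃) * θ ^ 2 + φ (v₁ + v₂ + v₃) * θ + φ (w₁ + w₂ + w₃)) := by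
      apply CharTwo.add_eq_zero.1
      rw [← hsum, e₁, e₂, e₃]
      simp only [map_add]
      ring
    intro i
    fin_cases i
    exacts [e₁, e₂, e₃, e₄]
  have hs : ∀ c₁ c₂ c₃ : K, ∑ i, (![c₁, c₂, c₃, c₁ + c₂ + c₃] : Fin 4 → K) i = 0 := by
    intro c₁ c₂ c₃
    rw [Fin.sum_univ_four]
    exact CharTwo.add_self_eq_zero (c₁ + c₂ + c₃)
  -- Dividing by `μ` replaces `a i` by `a i / n`, whose square is the norm of `x i / μ`.
  obtain ⟨n, hn⟩ := exists_sq_eq (Algebra.norm K μ)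
  have hn0 : n ≠ 0 := by
    rintro rfl
    rw [zero_pow two_ne_zero, eq_comm, Algebra.norm_eq_zero_iff] at hn
    exact hμ hn
  set M := AlgebraicClosure K
  set ψ := algebraMap K M with hψ
  have : CharP M 2 := charP_of_injective_algebraMap ψ.injective 2
  have hσ : ∀ (σ : L →ₐ[K] M) i, σ (x i / μ) = ψ (u i) * σ θ ^ 2 + ψ (v i) * σ θ + ψ (w i) := by
    intro σ i
    rw [hx i, mul_div_cancel_left₀ _ hμ]
    simp only [map_add, map_mul, map_pow, AlgHom.commutes, hψ]
  have hdet := quadDet_eq_zero (M := M) (ι := L →ₐ[K] M) (by rw [AlgHom.card, h5]) (fun σ => σ θ)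
    ((Field.primitive_element_iff_algHom_eq_of_eval' K M
      (fun _ => IsAlgClosed.splits _) θ).1 (adjoin_eq_top_of_finrank_five h5 hθ))
    (fun i => ψ (u i)) (fun i => ψ (v i)) (fun i => ψ (w i)) (fun i => ψ (a i / n))
    (by rw [← map_sum, hs, map_zero]) (by rw [← map_sum, hs, map_zero])
    (by rw [← map_sum, hs, map_zero])
    (fun i => by
      rw [Ne, map_eq_zero]
      exact div_ne_zero (h.ne_zero' h5 i) hn0)
    (fun i => by
      simp only [← hσ]
      rw [← Algebra.norm_eq_prod_embeddings, ← map_pow, div_pow, h.sq_eq_norm, hn]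
      congr 1
      rw [eq_div_iff (by rw [← hn]; exact pow_ne_zero 2 hn0), ← map_mul, div_mul_cancel₀ _ hμ])
    (fun σ => by
      simp only [← hσ]
      have hr := congrArg σ h.sum_div_eq
      simp only [map_sum, map_div₀, AlgHom.commutes, map_zero] at hr
      rw [← mul_zero (σ μ / ψ n), ← hr, Finset.mul_sum]
      refine Finset.sum_congr rfl fun i _ => ?_
      simp only [map_div₀]
      rw [div_div_div_eq, div_mul_div_comm, mul_comm (ψ (a i))])
  have hdet' : quadDet u v w = 0 := by
    apply ψ.injective
    rw [map_zero, ← hdet]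
    simp [quadDet]
  -- A left kernel vector of the coefficient matrix is a linear relation among `x 0, x 1, x 2`.
  have hmat : (!![u 0, v 0, w 0; u 1, v 1, w 1; u 2, v 2, w 2] : Matrix (Fin 3) (Fin 3) K).det
      = 0 := by
    rw [Matrix.det_fin_three, ← hdet']
    simp only [Matrix.of_apply, Matrix.cons_val, quadDet, CharTwo.sub_eq_add]
    ring
  obtain ⟨c, hc0, hc⟩ := Matrix.exists_vecMul_eq_zero_iff.2 hmat
  have k0 := congrFun hc 0
  have k1 := congrFun hc 1
  have k2 := congrFun hc 2
  simp only [Matrix.vecMul, dotProduct, Fin.sum_univ_three, Matrix.of_apply, Matrix.cons_val,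
    Pi.zero_apply] at k0 k1 k2
  obtain ⟨z₀, z₁, z₂⟩ := hlin (c 0) (c 1) (c 2) (by
    have l0 := congrArg φ k0
    have l1 := congrArg φ k1
    have l2 := congrArg φ k2
    simp only [map_add, map_mul, map_zero] at l0 l1 l2
    rw [hx 0, hx 1, hx 2]
    linear_combination μ * θ ^ 2 * l0 + μ * θ * l1 + μ * l2)
  apply hc0
  funext i
  fin_cases i
  exacts [z₀, z₁, z₂]

end Quadruple

/-! ### The power map `x ^ d`: injectivity and APN property -/

section PowerMap

variable {K F : Type*} [Field K] [Fintype K] [Field F] [Algebra K F]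

local notation "φ" => algebraMap K F

theorem mem_range_algebraMap_of_pow_card_eq {x : F} (hx : x ^ Fintype.card K = x) :
    x ∈ Set.range φ := by
  classical
  by_contra h
  have hq : 1 < Fintype.card K := Fintype.one_lt_card
  have hdeg := FiniteField.X_pow_card_sub_X_natDegree_eq F hq
  have hne := FiniteField.X_pow_card_sub_X_ne_zero F hq
  have hcard := card_le_degree_of_subset_roots (p := (X ^ Fintype.card K - X : F[X]))
    (Z := insert x (Finset.univ.image φ)) (by
      intro y hy
      rw [Finset.mem_val, Finset.mem_insert, Finset.mem_image] at hy
      rw [mem_roots hne, IsRoot, eval_sub, eval_pow, eval_X, sub_eq_zero]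
      rcases hy with rfl | ⟨z, -, rfl⟩
      · exact hx
      · rw [← map_pow, FiniteField.pow_card])
  rw [Finset.card_insert_of_notMem (by simpa using h),
    Finset.card_image_of_injective _ (algebraMap K F).injective, Finset.card_univ, hdeg] at hcard
  omega

theorem pow_injective_of_coprime {n : ℕ} (hn : n ≠ 0)
    (h : (Fintype.card K - 1).Coprime n) : Function.Injective fun x : K => x ^ n := by
  classical
  have hinj : Function.Injective fun x : Kˣ => x ^ n :=
    (powCoprime (G := Kˣ) (n := n) (by rwa [Nat.card_eq_fintype_card, Fintype.card_units])).injective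
  intro x y hxy
  simp only at hxy
  rcases eq_or_ne x 0 with rfl | hx
  · rw [zero_pow hn, eq_comm, pow_eq_zero_iff hn] at hxy
    exact hxy.symm
  · have hy : y ≠ 0 := by
      rintro rfl
      rw [zero_pow hn, pow_eq_zero_iff hn] at hxy
      exact hx hxy
    have := hinj (a₁ := Units.mk0 x hx) (a₂ := Units.mk0 y hy) (by ext; simpa using hxy)
    simpa using congrArg Units.val this

variable [Fintype F]

theorem finrank_eq_five {k : ℕ} (hk : k ≠ 0) (hK : Fintype.card K = 2 ^ k)
    (hF : Fintype.card F = 2 ^ (5 * k)) : Module.finrank K F = 5 := by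
  have h := Module.card_eq_pow_finrank (K := K) (V := F)
  rw [hK, hF, ← pow_mul] at h
  have := Nat.pow_right_injective le_rfl h
  rw [mul_comm] at this
  exact (Nat.eq_of_mul_eq_mul_left (Nat.pos_of_ne_zero hk) this).symm

theorem dobbertinExp_add_two (k : ℕ) :
    dobbertinExp k + 2 = ∑ i ∈ Finset.range 5, (2 ^ k) ^ i := by
  have : 1 ≤ 2 ^ k := Nat.one_le_two_pow
  simp only [Finset.sum_range_succ, Finset.sum_range_zero, dobbertinExp, ← pow_mul, mul_comm k,
    zero_mul, one_mul, pow_zero]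
  generalize 2 ^ (4 * k) = a
  generalize 2 ^ (3 * k) = b
  generalize 2 ^ (2 * k) = c
  generalize 2 ^ k = d at *
  omega

theorem dobbertinExp_ne_zero (k : ℕ) : dobbertinExp k ≠ 0 := by
  have h1 : 1 ≤ 2 ^ k := Nat.one_le_two_pow
  have h2 : 1 ≤ 2 ^ (2 * k) := Nat.one_le_two_pow
  unfold dobbertinExp
  generalize 2 ^ (4 * k) = a
  generalize 2 ^ (3 * k) = b
  generalize 2 ^ (2 * k) = c at *
  generalize 2 ^ k = d at *
  omega

theorem pow_dobbertinExp_mul_sq {k : ℕ} (hk : k ≠ 0) (hK : Fintype.card K = 2 ^ k)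
    (hF : Fintype.card F = 2 ^ (5 * k)) (x : F) :
    x ^ dobbertinExp k * x ^ 2 = φ (Algebra.norm K x) := by
  rw [← pow_add, dobbertinExp_add_two, FiniteField.algebraMap_norm_eq_pow_sum,
    finrank_eq_five hk hK hF, Nat.card_eq_fintype_card, hK]

/-- The norm of `x ^ d` is `N(x) ^ 5 / N(x) ^ 2 = N(x) ^ 3`, and cubing is injective on `K` because
`k` is odd. So `x ^ d` determines `N(x)`, hence `x²`, hence `x`. -/
theorem pow_dobbertinExp_injective {k : ℕ} (hk : Odd k) (hK : Fintype.card K = 2 ^ k)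
    (hF : Fintype.card F = 2 ^ (5 * k)) [CharP K 2] :
    Function.Injective fun x : F => x ^ dobbertinExp k := by
  have hk0 : k ≠ 0 := by rintro rfl; simp at hk
  have h5 := finrank_eq_five hk0 hK hF
  have : CharP F 2 := charP_of_injective_algebraMap (algebraMap K F).injective 2
  have hd := dobbertinExp_ne_zero k
  have hcube : Function.Injective fun x : K => x ^ 3 := by
    refine pow_injective_of_coprime (by norm_num) ?_
    have := Nat.pow_sub_one_gcd_pow_sub_one 2 k 2
    rw [hK, Nat.Coprime, show (3 : ℕ) = 2 ^ 2 - 1 by norm_num, this,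
      Nat.Coprime.gcd_eq_one (Nat.coprime_two_right.2 hk)]
    norm_num
  intro x y hxy
  simp only at hxy
  rcases eq_or_ne x 0 with rfl | hx
  · rw [zero_pow hd, eq_comm, pow_eq_zero_iff hd] at hxy
    exact hxy.symm
  have hNx : Algebra.norm K x ≠ 0 := by rwa [Ne, Algebra.norm_eq_zero_iff]
  have hy : y ≠ 0 := by
    rintro rfl
    rw [zero_pow hd, pow_eq_zero_iff hd] at hxy
    exact hx hxy
  have hNy : Algebra.norm K y ≠ 0 := by rwa [Ne, Algebra.norm_eq_zero_iff]
  have key : ∀ z : F, Algebra.norm K z ≠ 0 →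
      Algebra.norm K (z ^ dobbertinExp k) = Algebra.norm K z ^ 3 := by
    intro z hz
    have := congrArg (Algebra.norm K) (pow_dobbertinExp_mul_sq hk0 hK hF z)
    rw [map_mul, Algebra.norm_algebraMap, h5, map_pow _ z 2] at this
    apply mul_right_cancel₀ (pow_ne_zero 2 hz)
    rw [this]
    ring
  have hN : Algebra.norm K x = Algebra.norm K y := by
    apply hcube
    simp only
    rw [← key x hNx, ← key y hNy, hxy]
  have h1 := pow_dobbertinExp_mul_sq hk0 hK hF x
  have h2 := pow_dobbertinExp_mul_sq hk0 hK hF y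
  rw [hN, ← h2, hxy] at h1
  exact eq_of_sq_eq_sq_charTwo (mul_left_cancel₀ (pow_ne_zero _ hy) h1)

variable [CharP K 2]

theorem exists_pow_dobbertinExp_eq {k : ℕ} (hk : k ≠ 0) (hK : Fintype.card K = 2 ^ k)
    (hF : Fintype.card F = 2 ^ (5 * k)) (x : F) :
    ∃ a : K, a ^ 2 = Algebra.norm K x ∧ x ^ dobbertinExp k = (φ a / x) ^ 2 := by
  obtain ⟨a, ha⟩ := exists_sq_eq (Algebra.norm K x)
  refine ⟨a, ha, ?_⟩
  -- The formula also holds at zero, by the convention `a / 0 = 0`.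
  rcases eq_or_ne x 0 with rfl | hx
  · simp [dobbertinExp_ne_zero]
  · rw [div_pow, eq_div_iff (pow_ne_zero 2 hx), pow_dobbertinExp_mul_sq hk hK hF, ← ha, map_pow]

/-- Handles a quadruple with one zero element, whose term `a / 0` drops out. -/
theorem false_of_vanishing_triple (h5 : Module.finrank K F = 5) (x₁ x₂ x₃ : F)
    (a₁ a₂ a₃ : K) (n₁ : x₁ ≠ 0) (n₂ : x₂ ≠ 0) (n₃ : x₃ ≠ 0) (hs : x₁ + x₂ + x₃ = 0)
    (h₁ : a₁ ^ 2 = Algebra.norm K x₁) (h₂ : a₂ ^ 2 = Algebra.norm K x₂)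
    (h₃ : a₃ ^ 2 = Algebra.norm K x₃) (hr : φ a₁ / x₁ + φ a₂ / x₂ + φ a₃ / x₃ = 0) : False := by
  have hF : CharP F 2 := charP_of_injective_algebraMap (algebraMap K F).injective 2
  obtain ⟨θ, rfl⟩ : ∃ θ, x₁ = θ * x₂ := ⟨x₁ / x₂, (div_mul_cancel₀ _ n₂).symm⟩
  have hx₃ : x₃ = (θ + 1) * x₂ := by
    apply CharTwo.add_eq_zero.1
    rw [← hs]
    ring
  subst hx₃
  have m₁ := left_ne_zero_of_mul n₁
  have m₃ := left_ne_zero_of_mul n₃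
  have hr' : φ a₁ / θ + φ a₂ + φ a₃ / (θ + 1) = 0 := by
    rw [← mul_zero x₂, ← hr]
    field_simp
  by_cases hθ : θ ∈ Set.range φ
  · obtain ⟨c, rfl⟩ := hθ
    have hc : c ≠ 0 := by simpa using m₁
    have hc1 : c + 1 ≠ 0 := by
      intro h0
      apply m₃
      rw [← map_one φ, ← map_add, h0, map_zero]
    have hrK : a₁ / c + a₂ + a₃ / (c + 1) = 0 := by
      apply (algebraMap K F).injective
      simpa using hr'
    rw [norm_algebraMap_mul h5] at h₁
    rw [← map_one φ, ← map_add, norm_algebraMap_mul h5] at h₃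
    have hN0 : Algebra.norm K x₂ ≠ 0 := by rwa [Ne, Algebra.norm_eq_zero_iff]
    have hsq : (a₁ / c + a₂ + a₃ / (c + 1)) ^ 2 = 0 := by rw [hrK]; simp
    rw [CharTwo.add_sq, CharTwo.add_sq, div_pow, div_pow, h₁, h₂, h₃] at hsq
    have hcube : Algebra.norm K x₂ * (c ^ 3 + 1 + (c + 1) ^ 3) = 0 := by
      rw [← hsq]
      field_simp
    have hcube' := (mul_eq_zero.1 hcube).resolve_left hN0
    have : c * (c + 1) = 0 := by
      clear * - hcube'
      grind
    exact (mul_ne_zero hc hc1) this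
  · have hpoly := coeff_eq_zero_of_cubic_relation h5 hθ 0 a₂ (a₁ + a₂ + a₃) a₁ (by
      simp only [map_zero, map_add, zero_mul, zero_add]
      rw [← mul_zero (θ * (θ + 1)), ← hr']
      field_simp
      ring)
    have : a₁ = 0 := hpoly.2.2.2
    rw [this, zero_pow two_ne_zero, eq_comm, Algebra.norm_eq_zero_iff] at h₁
    exact n₁ h₁

/-- Four distinct elements with sum zero have `d`-th powers with nonzero sum. -/
theorem sum_pow_dobbertinExp_ne_zero {k : ℕ} (hk : k ≠ 0) (hK : Fintype.card K = 2 ^ k)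
    (hF : Fintype.card F = 2 ^ (5 * k)) (x : Fin 4 → F) (hx : Function.Injective x)
    (hs : ∑ i, x i = 0) : ∑ i, x i ^ dobbertinExp k ≠ 0 := by
  have h5 := finrank_eq_five hk hK hF
  have hF2 : CharP F 2 := charP_of_injective_algebraMap (algebraMap K F).injective 2
  intro h
  choose a ha hxa using fun i => exists_pow_dobbertinExp_eq hk hK hF (x i)
  simp only [hxa, ← CharTwo.sum_sq] at h
  have hr := pow_eq_zero_iff two_ne_zero |>.1 h
  by_cases h0 : ∀ i, x i ≠ 0
  · exact not_isVanishingQuadruple h5 a x ⟨hx, h0, hs, ha, hr⟩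
  · push Not at h0
    obtain ⟨i, hi⟩ := h0
    obtain ⟨σ, hσ⟩ : ∃ σ : Equiv.Perm (Fin 4), σ 3 = i := ⟨Equiv.swap 3 i, Equiv.swap_apply_left _ _⟩
    have hne : ∀ j, j ≠ 3 → x (σ j) ≠ 0 := by
      intro j hj hz
      rw [← hi, ← hσ] at hz
      exact hj (σ.injective (hx hz))
    rw [← Equiv.sum_comp σ, Fin.sum_univ_four, hσ, hi, add_zero] at hs
    rw [← Equiv.sum_comp σ, Fin.sum_univ_four, hσ, hi, div_zero, add_zero] at hr
    exact false_of_vanishing_triple h5 _ _ _ _ _ _ (hne 0 (by decide)) (hne 1 (by decide))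
      (hne 2 (by decide)) hs (ha _) (ha _) (ha _) hr

/-- The power map `x ↦ x ^ d` is almost perfect nonlinear. -/
theorem eq_or_eq_add_of_pow_dobbertinExp {k : ℕ} (hk : k ≠ 0) (hK : Fintype.card K = 2 ^ k)
    (hF : Fintype.card F = 2 ^ (5 * k)) {a x y : F} (ha : a ≠ 0)
    (h : (x + a) ^ dobbertinExp k + x ^ dobbertinExp k =
      (y + a) ^ dobbertinExp k + y ^ dobbertinExp k) : y = x ∨ y = x + a := by
  have hF2 : CharP F 2 := charP_of_injective_algebraMap (algebraMap K F).injective 2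
  by_contra hne
  push Not at hne
  obtain ⟨h1, h2⟩ := hne
  refine sum_pow_dobbertinExp_ne_zero hk hK hF ![x, x + a, y, y + a] ?_ ?_ ?_
  · have e1 : x ≠ x + a := fun h => ha (by simpa using h.symm)
    have e2 : y ≠ y + a := fun h => ha (by simpa using h.symm)
    have e3 : x ≠ y + a := fun h => h2 (by rw [h, add_assoc, CharTwo.add_self_eq_zero, add_zero])
    have e4 : x + a ≠ y + a := fun h => h1 (add_right_cancel h).symm
    intro i j hij
    fin_cases i <;> fin_cases j <;> first
      | rfl
      | exact absurd hij e1
      | exact absurd hij e2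
      | exact absurd hij e3
      | exact absurd hij e4
      | exact absurd hij h1.symm
      | exact absurd hij h2.symm
      | exact absurd hij.symm e1
      | exact absurd hij.symm e2
      | exact absurd hij.symm e3
      | exact absurd hij.symm e4
      | exact absurd hij.symm h1.symm
      | exact absurd hij.symm h2.symm
  · rw [Fin.sum_univ_four]
    show x + (x + a) + y + (y + a) = 0
    linear_combination (x + y + a) * CharTwo.two_eq_zero (R := F)
  · rw [Fin.sum_univ_four]
    show x ^ dobbertinExp k + (x + a) ^ dobbertinExp k + y ^ dobbertinExp k
      + (y + a) ^ dobbertinExp k = 0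
    linear_combination h + ((y + a) ^ dobbertinExp k + y ^ dobbertinExp k) *
      CharTwo.two_eq_zero (R := F)

end PowerMap

/-! ### Affine invariance of differential uniformity -/

section Affine

variable {K : Type*} [Field K] [Fintype K] [DecidableEq K]

theorem diffCount_le_differentialUniformity (f : K → K) {a : K} (ha : a ≠ 0) (b : K) :
    diffCount f a b ≤ differentialUniformity f :=
  Finset.le_sup (f := fun p : K × K => diffCount f p.1 p.2)
    (Finset.mem_filter.2 ⟨Finset.mem_univ (a, b), ha⟩)

theorem differentialUniformity_le {f : K → K} {n : ℕ}
    (h : ∀ a b, a ≠ 0 → diffCount f a b ≤ n) : differentialUniformity f ≤ n :=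
  Finset.sup_le fun p hp => h p.1 p.2 (Finset.mem_filter.1 hp).2

theorem diffCount_affine_comp [Algebra (ZMod 2) K] (p : K → K) (L₁ L₂ : K ≃ᵃ[ZMod 2] K) (a b : K) :
    diffCount (fun x => L₁ (p (L₂ x))) a (L₁.linear b) = diffCount p (L₂.linear a) b := by
  have : CharP K 2 := charP_of_injective_algebraMap (algebraMap (ZMod 2) K).injective 2
  unfold diffCount
  refine Finset.card_bij (fun x _ => L₂ x) ?_ (fun x _ y _ h => L₂.injective h) ?_
  all_goals
    have key : ∀ x, L₁ (p (L₂ (x + a))) + L₁ (p (L₂ x)) = L₁.linear b ↔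
        p (L₂ x + L₂.linear a) + p (L₂ x) = b := by
      intro x
      have h₂ : L₂ (x + a) = L₂ x + L₂.linear a := by
        have := L₂.map_vadd x a
        rwa [vadd_eq_add, vadd_eq_add, add_comm, add_comm (L₂.linear a)] at this
      have h₁ : ∀ y z, L₁ y + L₁ z = L₁.linear (y + z) := by
        intro y z
        rw [← CharTwo.sub_eq_add, ← CharTwo.sub_eq_add y]
        exact (L₁.toAffineMap.linearMap_vsub y z).symm
      rw [h₂, h₁, L₁.linear.injective.eq_iff]
  · intro x hx
    simpa [key] using hx
  · intro y hy
    refine ⟨L₂.symm y, ?_, by simp⟩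
    simpa [key] using hy

theorem differentialUniformity_affine_comp [Algebra (ZMod 2) K] (p : K → K)
    (L₁ L₂ : K ≃ᵃ[ZMod 2] K) :
    differentialUniformity (fun x => L₁ (p (L₂ x))) = differentialUniformity p := by
  apply le_antisymm
  · refine differentialUniformity_le fun a b ha => ?_
    obtain ⟨b, rfl⟩ := L₁.linear.surjective b
    rw [diffCount_affine_comp]
    exact diffCount_le_differentialUniformity _ (by simpa using ha) _
  · refine differentialUniformity_le fun a b ha => ?_
    obtain ⟨a, rfl⟩ := L₂.linear.surjective a
    rw [← diffCount_affine_comp p L₁ L₂]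
    exact diffCount_le_differentialUniformity _ (by rintro rfl; simp at ha) _

end Affine

theorem card_le_two_of_eq_or {F : Type*} [Add F] [DecidableEq F]
    {s : Finset F} {a : F} (h : ∀ x ∈ s, ∀ y ∈ s, y = x ∨ y = x + a) : s.card ≤ 2 := by
  rcases s.eq_empty_or_nonempty with rfl | ⟨x, hx⟩
  · simp
  · refine (Finset.card_le_card (t := {x, x + a}) fun y hy => ?_).trans Finset.card_le_two
    simpa using h x hx y hy

/-! ### Replacing the power map on the subfield -/

section Modified

variable {K F : Type*} [Field K] [Fintype K] [CharP K 2] [Field F] [Fintype F] [Algebra K F]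

local notation "φ" => algebraMap K F

theorem pow_dobbertinExp_mem_range {k : ℕ} (hk : Odd k) (hK : Fintype.card K = 2 ^ k)
    (hF : Fintype.card F = 2 ^ (5 * k)) {x : F} (hx : x ^ dobbertinExp k ∈ Set.range φ) :
    x ∈ Set.range φ := by
  have hinj := pow_dobbertinExp_injective (K := K) (F := F) hk hK hF
  have hinjK : Function.Injective fun z : K => z ^ dobbertinExp k := by
    intro y z h
    apply (algebraMap K F).injective
    apply hinj
    simp only at h
    simp only
    rw [← map_pow, ← map_pow, h]
  obtain ⟨w, hw⟩ := hx
  obtain ⟨z, hz⟩ := (Finite.injective_iff_surjective.1 hinjK) w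
  refine ⟨z, hinj ?_⟩
  simp only at hz ⊢
  rw [← map_pow, hz, hw]

theorem bijective_of_modified {k : ℕ} (hk : Odd k) (hK : Fintype.card K = 2 ^ k)
    (hF : Fintype.card F = 2 ^ (5 * k)) {G : K → K} (hG : Function.Injective G) {f : F → F}
    (hin : ∀ z, f (φ z) = φ (G z)) (hout : ∀ x, x ∉ Set.range φ → f x = x ^ dobbertinExp k) :
    Function.Bijective f := by
  refine Finite.injective_iff_bijective.1 fun x y h => ?_
  by_cases hx : x ∈ Set.range φ
  · obtain ⟨z, rfl⟩ := hx
    rw [hin] at h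
    by_cases hy : y ∈ Set.range φ
    · obtain ⟨w, rfl⟩ := hy
      rw [hin] at h
      rw [hG ((algebraMap K F).injective h)]
    · rw [hout y hy] at h
      exact absurd (pow_dobbertinExp_mem_range hk hK hF ⟨_, h⟩) hy
  · rw [hout x hx] at h
    by_cases hy : y ∈ Set.range φ
    · obtain ⟨w, rfl⟩ := hy
      rw [hin] at h
      exact absurd (pow_dobbertinExp_mem_range hk hK hF ⟨_, h.symm⟩) hx
    · rw [hout y hy] at h
      exact pow_dobbertinExp_injective (K := K) hk hK hF h

/-- With `a` and `b` in the subfield, the derivative equation of `x ^ d` has no solution outside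
the subfield. -/
theorem mem_range_of_pow_dobbertinExp_add {k : ℕ} (hk : k ≠ 0) (hK : Fintype.card K = 2 ^ k)
    (hF : Fintype.card F = 2 ^ (5 * k)) {a b : K} (ha : a ≠ 0) {x : F}
    (h : (x + φ a) ^ dobbertinExp k + x ^ dobbertinExp k = φ b) : x ∈ Set.range φ := by
  have hF2 : CharP F 2 := charP_of_injective_algebraMap (algebraMap K F).injective 2
  have hadd : ∀ y z : F, (y + z) ^ Fintype.card K = y ^ Fintype.card K + z ^ Fintype.card K := by
    intro y z
    rw [hK, add_pow_char_pow]
  have hφ : ∀ c : K, φ c ^ Fintype.card K = φ c := fun c => by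
    rw [← map_pow, FiniteField.pow_card]
  have h' : (x ^ Fintype.card K + φ a) ^ dobbertinExp k + (x ^ Fintype.card K) ^ dobbertinExp k
      = φ b := by
    rw [← hφ b, ← h, hadd, ← pow_mul, ← pow_mul, mul_comm (dobbertinExp k),
      pow_mul (x + φ a), hadd, hφ, pow_mul, pow_right_comm]
  -- The Frobenius conjugate `x ^ q` solves the same equation, so it is `x` or `x + a`. In the
  -- second case `x` is fixed by the square of Frobenius, which has order dividing 5 on `F`, so `x`
  -- is fixed by Frobenius too.
  rcases eq_or_eq_add_of_pow_dobbertinExp (K := K) hk hK hF (by simpa using ha)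
    (h.trans h'.symm) with h1 | h1
  · exact mem_range_algebraMap_of_pow_card_eq h1
  · have h2 : (x ^ Fintype.card K) ^ Fintype.card K = x := by
      rw [h1, hadd, h1, hφ, add_assoc, CharTwo.add_self_eq_zero, add_zero]
    have h5 : x ^ Fintype.card K ^ 5 = x := by
      have := FiniteField.pow_card x
      rwa [hF, mul_comm, pow_mul, ← hK] at this
    apply mem_range_algebraMap_of_pow_card_eq
    rwa [show Fintype.card K ^ 5 = Fintype.card K * Fintype.card K * Fintype.card K *
      Fintype.card K * Fintype.card K by ring, pow_mul, pow_mul, pow_mul, pow_mul, h2, h2] at h5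

/-- For `a` outside the subfield, the values `(z + a) ^ d` for `z` in the subfield lie in distinct
cosets of the subfield. -/
theorem eq_of_pow_dobbertinExp_add_mem {k : ℕ} (hk : k ≠ 0) (hK : Fintype.card K = 2 ^ k)
    (hF : Fintype.card F = 2 ^ (5 * k)) {a : F} (ha : a ∉ Set.range φ) {y z c : K}
    (h : (φ y + a) ^ dobbertinExp k + (φ z + a) ^ dobbertinExp k = φ c) : y = z := by
  have hF2 : CharP F 2 := charP_of_injective_algebraMap (algebraMap K F).injective 2
  have h5 := finrank_eq_five hk hK hF
  have hne : ∀ y : K, φ y + a ≠ 0 := fun y h0 => ha ⟨y, CharTwo.add_eq_zero.1 h0⟩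
  obtain ⟨p, hp, hp'⟩ := exists_pow_dobbertinExp_eq hk hK hF (φ y + a)
  obtain ⟨r, hr, hr'⟩ := exists_pow_dobbertinExp_eq hk hK hF (φ z + a)
  obtain ⟨e, rfl⟩ := exists_sq_eq c
  rw [hp', hr', ← CharTwo.add_sq, map_pow] at h
  have hE := eq_of_sq_eq_sq_charTwo h
  have hp0 : p ≠ 0 := by
    rintro rfl
    rw [zero_pow two_ne_zero, eq_comm, Algebra.norm_eq_zero_iff] at hp
    exact hne y hp
  have hy := hne y
  have hz := hne z
  -- Clearing denominators in `p / (y + a) + r / (z + a) = e` gives a quadratic relation for `a`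
  -- over `K`, so all its coefficients vanish.
  have hpoly := coeff_eq_zero_of_cubic_relation h5 ha 0 e (e * (y + z) - (p + r))
    (e * (y * z) - (p * z + r * y)) (by
      simp only [map_zero, map_add, map_sub, map_mul, zero_mul, zero_add]
      field_simp at hE
      linear_combination -hE)
  obtain ⟨-, he, h1, h0⟩ := hpoly
  rw [he] at h1 h0
  have hpr : p = r := CharTwo.add_eq_zero.1 (by linear_combination -h1)
  rw [← hpr] at h0
  have : p * (y + z) = 0 := by linear_combination -h0
  exact CharTwo.add_eq_zero.1 ((mul_eq_zero.1 this).resolve_left hp0)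

variable [DecidableEq K] [DecidableEq F]

theorem diffCount_modified_of_mem {k : ℕ} (hk : k ≠ 0) (hK : Fintype.card K = 2 ^ k)
    (hF : Fintype.card F = 2 ^ (5 * k)) {G : K → K} {f : F → F}
    (hin : ∀ z, f (φ z) = φ (G z)) (hout : ∀ x, x ∉ Set.range φ → f x = x ^ dobbertinExp k)
    {a : K} (ha : a ≠ 0) (b : K) : diffCount f (φ a) (φ b) = diffCount G a b := by
  unfold diffCount
  symm
  refine Finset.card_bij (fun z _ => φ z) ?_ (fun x _ y _ h => (algebraMap K F).injective h) ?_
  · intro z hz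
    have hz' : G (z + a) + G z = b := by simpa using hz
    simp [← map_add, hin, hz']
  · intro x hx
    have hx' : f (x + φ a) + f x = φ b := by simpa using hx
    have hmem : x ∈ Set.range φ := by
      by_contra hxm
      have hxa : x + φ a ∉ Set.range φ := by
        rintro ⟨w, hw⟩
        exact hxm ⟨w - a, by rw [map_sub, hw, add_sub_cancel_right]⟩
      rw [hout _ hxm, hout _ hxa] at hx'
      exact hxm (mem_range_of_pow_dobbertinExp_add hk hK hF ha hx')
    obtain ⟨z, rfl⟩ := hmem
    refine ⟨z, ?_, rfl⟩
    rw [← map_add, hin, hin, ← map_add] at hx'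
    simpa using (algebraMap K F).injective hx'

theorem diffCount_modified_le {k : ℕ} (hk : k ≠ 0) (hK : Fintype.card K = 2 ^ k)
    (hF : Fintype.card F = 2 ^ (5 * k)) {G : K → K} {f : F → F}
    (hin : ∀ z, f (φ z) = φ (G z)) (hout : ∀ x, x ∉ Set.range φ → f x = x ^ dobbertinExp k)
    {a : F} (ha : a ≠ 0) (b : F) : diffCount f a b ≤ max 4 (differentialUniformity G) := by
  classical
  have hF2 : CharP F 2 := charP_of_injective_algebraMap (algebraMap K F).injective 2
  set s := Finset.univ.filter fun x : F => f (x + a) + f x = b with hs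
  have hmem : ∀ x, x ∈ s ↔ f (x + a) + f x = b := by simp [hs]
  have hsout : ((s.filter fun x => x ∉ Set.range φ ∧ x + a ∉ Set.range φ)).card ≤ 2 := by
    refine card_le_two_of_eq_or (a := a) fun x hx y hy => ?_
    simp only [Finset.mem_filter, hmem] at hx hy
    obtain ⟨hx, hx1, hx2⟩ := hx
    obtain ⟨hy, hy1, hy2⟩ := hy
    rw [hout _ hx1, hout _ hx2] at hx
    rw [hout _ hy1, hout _ hy2] at hy
    exact eq_or_eq_add_of_pow_dobbertinExp (K := K) hk hK hF ha (hx.trans hy.symm)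
  by_cases haK : a ∈ Set.range φ
  · obtain ⟨a, rfl⟩ := haK
    have ha' : a ≠ 0 := by rintro rfl; simp at ha
    by_cases hbK : b ∈ Set.range φ
    · obtain ⟨b, rfl⟩ := hbK
      rw [diffCount_modified_of_mem hk hK hF hin hout ha']
      exact (diffCount_le_differentialUniformity G ha' b).trans (le_max_right _ _)
    · refine le_trans ?_ (le_max_left _ _)
      refine le_trans (Finset.card_le_card (fun x hx => ?_)) (hsout.trans (by norm_num))
      have hx' := (hmem x).1 hx
      have hxm : x ∉ Set.range φ := by
        rintro ⟨z, rfl⟩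
        rw [← map_add, hin, hin, ← map_add] at hx'
        exact hbK ⟨_, hx'⟩
      refine Finset.mem_filter.2 ⟨hx, hxm, ?_⟩
      rintro ⟨w, hw⟩
      exact hxm ⟨w - a, by rw [map_sub, hw, add_sub_cancel_right]⟩
  · refine le_trans ?_ (le_max_left _ _)
    have hshift : ∀ x, x ∈ Set.range φ → x + a ∉ Set.range φ := by
      rintro _ ⟨z, rfl⟩ ⟨w, hw⟩
      exact haK ⟨w - z, by rw [map_sub, hw, add_sub_cancel_left]⟩
    set T := s.filter fun x => x ∈ Set.range φ with hT
    have hTcard : T.card ≤ 1 := by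
      refine Finset.card_le_one.2 fun x hx y hy => ?_
      obtain ⟨hx, z, rfl⟩ := Finset.mem_filter.1 hx
      obtain ⟨hy, w, rfl⟩ := Finset.mem_filter.1 hy
      rw [hmem, hin, hout _ (hshift _ ⟨_, rfl⟩)] at hx hy
      rw [eq_of_pow_dobbertinExp_add_mem (y := z) (z := w) (c := G z + G w) hk hK hF haK (by
        rw [map_add]
        linear_combination hx - hy + ((φ w + a) ^ dobbertinExp k - φ (G z)) *
          CharTwo.two_eq_zero (R := F))]
    -- Solutions come in pairs `x, x + a`, so those with `x + a ∈ K` are the translate of `T`: the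
    -- total is at most 2 + 1 + 1.
    have hsub : s ⊆ (s.filter fun x => x ∉ Set.range φ ∧ x + a ∉ Set.range φ) ∪ T ∪
        T.image (· + a) := by
      intro x hx
      rw [Finset.mem_union, Finset.mem_union]
      by_cases hx1 : x ∈ Set.range φ
      · exact Or.inl (Or.inr (Finset.mem_filter.2 ⟨hx, hx1⟩))
      by_cases hx2 : x + a ∈ Set.range φ
      · have hxa : x + a + a = x := by rw [add_assoc, CharTwo.add_self_eq_zero, add_zero]
        refine Or.inr (Finset.mem_image.2 ⟨x + a, Finset.mem_filter.2 ⟨?_, hx2⟩, hxa⟩)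
        rw [hmem, hxa, add_comm]
        exact (hmem x).1 hx
      · exact Or.inl (Or.inl (Finset.mem_filter.2 ⟨hx, hx1, hx2⟩))
    have h1 := Finset.card_le_card hsub
    have h2 := Finset.card_union_le
      ((s.filter fun x => x ∉ Set.range φ ∧ x + a ∉ Set.range φ) ∪ T) (T.image (· + a))
    have h3 := Finset.card_union_le
      (s.filter fun x => x ∉ Set.range φ ∧ x + a ∉ Set.range φ) T
    have h4 := Finset.card_image_le (s := T) (f := (· + a))
    change s.card ≤ 4
    omega

theorem differentialUniformity_modified_le {k : ℕ} (hk : k ≠ 0) (hK : Fintype.card K = 2 ^ k)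
    (hF : Fintype.card F = 2 ^ (5 * k)) {G : K → K} {f : F → F}
    (hin : ∀ z, f (φ z) = φ (G z)) (hout : ∀ x, x ∉ Set.range φ → f x = x ^ dobbertinExp k) :
    differentialUniformity f ≤ max 4 (differentialUniformity G) :=
  differentialUniformity_le fun _ b ha => diffCount_modified_le hk hK hF hin hout ha b

theorem le_differentialUniformity_modified {k : ℕ} (hk : k ≠ 0) (hK : Fintype.card K = 2 ^ k)
    (hF : Fintype.card F = 2 ^ (5 * k)) {G : K → K} {f : F → F}
    (hin : ∀ z, f (φ z) = φ (G z)) (hout : ∀ x, x ∉ Set.range φ → f x = x ^ dobbertinExp k) :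
    differentialUniformity G ≤ differentialUniformity f := by
  refine differentialUniformity_le fun a b ha => ?_
  rw [← diffCount_modified_of_mem hk hK hF hin hout ha]
  exact diffCount_le_differentialUniformity f (by simpa using ha) _

end Modified

/-! ### The polynomial formula as a piecewise function, and the theorem -/

section Piecewise

variable {K F : Type*} [Field K] [Fintype K] [CharP K 2] [Field F] [Algebra K F]

theorem modifiedDobbertin_algebraMap {k : ℕ} (hk : k ≠ 0) (hK : Fintype.card K = 2 ^ k)
    (g : K[X]) (z : K) :
    modifiedDobbertin k g (algebraMap K F z) = algebraMap K F (g.eval z) := by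
  have h0 : algebraMap K F z + algebraMap K F z ^ 2 ^ k = 0 := by
    rw [← map_pow, ← hK, FiniteField.pow_card, ← map_add, CharTwo.add_self_eq_zero, map_zero]
  have he : 2 ^ (5 * k) - 1 ≠ 0 := by
    have := Nat.one_lt_two_pow (n := 5 * k) (by omega)
    omega
  rw [modifiedDobbertin, h0, zero_pow he, mul_zero, add_zero, aeval_algebraMap_apply,
    coe_aeval_eq_eval]

theorem modifiedDobbertin_of_notMem [Fintype F] {k : ℕ} (hK : Fintype.card K = 2 ^ k)
    (hF : Fintype.card F = 2 ^ (5 * k)) (g : K[X]) {x : F}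
    (hx : x ∉ Set.range (algebraMap K F)) : modifiedDobbertin k g x = x ^ dobbertinExp k := by
  have hF2 : CharP F 2 := charP_of_injective_algebraMap (algebraMap K F).injective 2
  have h0 : x + x ^ 2 ^ k ≠ 0 := fun h =>
    hx (mem_range_algebraMap_of_pow_card_eq (by rw [hK]; exact (CharTwo.add_eq_zero.1 h).symm))
  rw [modifiedDobbertin, ← hF, FiniteField.pow_card_sub_one_eq_one _ h0, mul_one, ← add_assoc,
    CharTwo.add_self_eq_zero, zero_add]

end Piecewise

theorem mainTheorem2 {K F : Type*} [Field K] [Fintype K] [DecidableEq K]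
    [Field F] [Fintype F] [DecidableEq F] [Algebra K F] [Algebra (ZMod 2) K]
    (k m : ℕ) (hk : Odd k) (hm : 1 ≤ m) (hkm : Nat.gcd k m = 1)
    (hK : Fintype.card K = 2 ^ k) (hF : Fintype.card F = 2 ^ (5 * k))
    (L₁ L₂ : K ≃ᵃ[ZMod 2] K)
    (g : Polynomial K) (hg : ∀ x : K, g.eval x = L₁ ((L₂ x) ^ (2 ^ m - 1))) :
    (differentialUniformity (fun x : K => x ^ (2 ^ m - 1)) = 2 →
      Function.Bijective (modifiedDobbertin k g : F → F) ∧
        differentialUniformity (modifiedDobbertin k g : F → F) ≤ 4) ∧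
    (differentialUniformity (fun x : K => x ^ (2 ^ m - 1)) = 4 →
      Function.Bijective (modifiedDobbertin k g : F → F) ∧
        differentialUniformity (modifiedDobbertin k g : F → F) = 4) ∧
    (differentialUniformity (fun x : K => x ^ (2 ^ m - 1)) = 6 →
      Function.Bijective (modifiedDobbertin k g : F → F) ∧
        differentialUniformity (modifiedDobbertin k g : F → F) = 6) := by
  have hK2 : CharP K 2 := charP_of_injective_algebraMap (algebraMap (ZMod 2) K).injective 2
  have hk0 : k ≠ 0 := by rintro rfl; simp at hk
  have hin (z : K) : modifiedDobbertin k g (algebraMap K F z) =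
      algebraMap K F (L₁ ((L₂ z) ^ (2 ^ m - 1))) := by
    rw [modifiedDobbertin_algebraMap hk0 hK, hg]
  have hout (x : F) (hx : x ∉ Set.range (algebraMap K F)) :
      modifiedDobbertin k g x = x ^ dobbertinExp k := modifiedDobbertin_of_notMem hK hF g hx
  have hpow : Function.Injective fun x : K => x ^ (2 ^ m - 1) := by
    refine pow_injective_of_coprime ?_ ?_
    · have := Nat.one_lt_two_pow (n := m) (by omega)
      omega
    · rw [hK, Nat.Coprime, Nat.pow_sub_one_gcd_pow_sub_one 2 k m, hkm]
      norm_num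
  have hbij : Function.Bijective (modifiedDobbertin k g : F → F) :=
    bijective_of_modified hk hK hF
      (fun x y h => L₂.injective (hpow (L₁.injective h))) hin hout
  have hle := differentialUniformity_modified_le hk0 hK hF hin hout
  have hge := le_differentialUniformity_modified hk0 hK hF hin hout
  have haff := differentialUniformity_affine_comp (fun x : K => x ^ (2 ^ m - 1)) L₁ L₂
  rw [haff] at hle hge
  refine ⟨fun h => ⟨hbij, ?_⟩, fun h => ⟨hbij, ?_⟩, fun h => ⟨hbij, ?_⟩⟩ <;>
  · rw [h] at hle hge
    omega
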